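/- All systems are finite-dimensional and nonzero, logarithms are in base $2$, $T_X$ is the transpose on system $X$, and $J_{\mathcal M}\in\mathcal L(AB)$ is the Choi matrix of a map $\mathcal M_{A'\to B}$ ($A\cong A'$). **Divergences.** For a state $\rho$, a positive semidefinite $\sigma$ and $\alpha\in(1,2]$, the geometric Rényi divergence is $$\widehat D_\alpha(\rho\|\sigma)=\tfrac1{\alpha-1}\log\operatorname{tr} G_{1-\alpha}(\rho,\sigma),\qquad G_{s}(X,Y)=X^{1/2}\big(X^{-1/2}YX^{-1/2}\big)^{s}X^{1/2},$$ if $\operatorname{supp}\rho\subseteq\operatorname{supp}\sigma$, and $+\infty$ otherwise; for singular $\rho$, $G_{1-\alpha}(\rho,\sigma)$ is understood as $G_\alpha(\sigma,\rho)=\sigma^{1/2}(\sigma^{-1/2}\rho\,\sigma^{-1/2})^\alpha\sigma^{1/2}$ with inverses on $\operatorname{supp}\sigma$ (the two agree for positive definite $\rho,\sigma$). Also $D_{\max}(\rho\|\sigma)=\inf\{\log t : t>0,\ \rho\le t\sigma\}$, with $\inf\emptyset=+\infty$. **Information quantities.** For a channel $\mathcal N_{A'\to B}$, with $\phi_{AA'}$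 a purification of $\rho_A$, $$\widehat R_{\alpha,\Theta}(\mathcal N)=\min_{\mathcal M\in\mathcal V_\Theta}\max_{\rho_A}\widehat D_\alpha\big(\mathcal N(\phi_{AA'})\big\|\mathcal M(\phi_{AA'})\big),\qquad R_{\max}(\mathcal N)=\max_{\rho_A}\min_{\sigma_{AB}}D_{\max}\big(\mathcal N(\phi_{AA'})\big\|\sigma_{AB}\big),$$ where $\mathcal V_\Theta$ is the set of completely positive maps $\mathcal M_{A'\to B}$ for which there is $Y_{AB}$ with $Y_{AB}\pm J_{\mathcal M}^{T_B}\ge0$ and $\operatorname{tr}_BY_{AB}\le 1_A$ (the subchannels with Holevo–Werner bound at most $0$), $\rho_A$ ranges over all states, and $\sigma_{AB}$ ranges over $\sigma_{AB}\ge0$ with $\|\sigma_{AB}^{T_B}\|_1\le1$. **Capacities.** Let $\mathcal O$ be a class of bipartite operations: PPT (channels $\mathcal P$ from $XY$ to $X'Y'$ with $T_{Y'}\circ\mathcal P\circ T_{Y}$ completely positive) or LOCC (finite compositions of rounds in which one party applies an instrument and announces the outcome, and the other applies a channel depending on it). An $\mathcal O$-assisted protocol with $n\ge 1$ uses of $\mathcal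 N$ starts from trivial systems and alternates $n+1$ operations in $\mathcal O$ with the $n$ uses of $\mathcal N$ (input from Alice, output to Bob, both keeping arbitrary finite-dimensional memories); its final state $\omega$ lives on two $k$-dimensional systems, one held by each party. It is an $(n,k,\varepsilon)$ protocol if $\operatorname{tr}\Phi_k\omega\ge1-\varepsilon$, with $\Phi_k$ the maximally entangled state. A rate $r\in\mathbb R$ is achievable if for all $\varepsilon\in(0,1)$, $\delta>0$ and all sufficiently large $n$ there is an $(n,k,\varepsilon)$ protocol with $k\ge2^{n(r-\delta)}$; it is a strong converse rate if for all $\varepsilon\in[0,1)$, $\delta>0$ and all sufficiently large $n$ there is no $(n,k,\varepsilon)$ protocol with $k\ge2^{n(r+\delta)}$. The $\mathcal O$-assisted quantum capacity is the supremum of the achievable rates, and the strong converse capacity is the infimum of the strong converse rates. They are written $Q^{\mathrm{PPT},\leftrightarrow}$, $Q^{\mathrm{PPT},\leftrightarrow,\dagger}$ for PPT and $Q^{\leftrightarrow}$, $Q^{\leftrightarrow,\dagger}$ for LOCC. **Theorem.** For every quantum channel $\mathcal N$ and every $\alpha\in(1,2]$, $$Q^{\mathrm{PPT},\leftrightarrow}(\mathcal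 N)\le Q^{\mathrm{PPT},\leftrightarrow,\dagger}(\mathcal N)\le\widehat R_{\alpha,\Theta}(\mathcal N)\le R_{\max}(\mathcal N).$$ Consequently $\widehat R_{\alpha,\Theta}$ is a strong converse bound on the two-way assisted quantum capacity: $Q^{\leftrightarrow}(\mathcal N)\le Q^{\leftrightarrow,\dagger}(\mathcal N)\le\widehat R_{\alpha,\Theta}(\mathcal N)$. -/

import Mathlib

open scoped Matrix ComplexOrder

noncomputable section

namespace QComm

/-! Quantum systems are finite types: a system `a` has Hilbert space `ℂ^a`, operators on it are
`Matrix a a ℂ`, and the joint system of `a` and `b` is `a × b`. -/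

section Basic

variable {a b c d r : Type}

/-- The linear maps from operators on `a` to operators on `b`. -/
abbrev SuperOp (a b : Type) : Type := Matrix a a ℂ →ₗ[ℂ] Matrix b b ℂ

/-- `id_r ⊗ Φ`, acting on operators of the joint system `r × a`. -/
def idTensor (r : Type) (Φ : SuperOp a b) : SuperOp (r × a) (r × b) where
  toFun X := Matrix.of fun i j =>
    Φ (Matrix.of fun x y => X (i.1, x) (j.1, y)) i.2 j.2
  map_add' X Y := by
    ext i j
    exact congrFun (congrFun (map_add Φ (Matrix.of fun x y => X (i.1, x) (j.1, y))
      (Matrix.of fun x y => Y (i.1, x) (j.1, y))) i.2) j.2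
  map_smul' t X := by
    ext i j
    exact congrFun (congrFun (map_smul Φ t
      (Matrix.of fun x y => X (i.1, x) (j.1, y))) i.2) j.2

/-- `Φ ⊗ id_r`, acting on operators of the joint system `a × r`. -/
def tensorId (r : Type) (Φ : SuperOp a b) : SuperOp (a × r) (b × r) where
  toFun X := Matrix.of fun i j =>
    Φ (Matrix.of fun x y => X (x, i.2) (y, j.2)) i.1 j.1
  map_add' X Y := by
    ext i j
    exact congrFun (congrFun (map_add Φ (Matrix.of fun x y => X (x, i.2) (y, j.2))
      (Matrix.of fun x y => Y (x, i.2) (y, j.2))) i.1) j.1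
  map_smul' t X := by
    ext i j
    exact congrFun (congrFun (map_smul Φ t
      (Matrix.of fun x y => X (x, i.2) (y, j.2))) i.1) j.1

/-- `Φ ⊗ Ψ`, as `(Φ ⊗ id) ∘ (id ⊗ Ψ)`. -/
def tensorMap (Φ : SuperOp a c) (Ψ : SuperOp b d) : SuperOp (a × b) (c × d) :=
  tensorId d Φ ∘ₗ idTensor a Ψ

/-- Complete positivity: every amplification `id_k ⊗ Φ` preserves positive semidefiniteness. -/
def IsCP (Φ : SuperOp a b) : Prop :=
  ∀ (k : ℕ) (X : Matrix (Fin k × a) (Fin k × a) ℂ),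
    X.PosSemidef → (idTensor (Fin k) Φ X).PosSemidef

/-- Trace preservation. -/
def IsTP [Fintype a] [Fintype b] (Φ : SuperOp a b) : Prop :=
  ∀ X : Matrix a a ℂ, (Φ X).trace = X.trace

/-- A quantum channel is a completely positive trace-preserving linear map. -/
def IsChannel [Fintype a] [Fintype b] (Φ : SuperOp a b) : Prop := IsCP Φ ∧ IsTP Φ

/-- Quantum states: density matrices. -/
def IsState [Fintype a] (ρ : Matrix a a ℂ) : Prop := ρ.PosSemidef ∧ ρ.trace = 1

/-- The rank-one operator `|ψ⟩⟨ψ|`. -/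
def ketBra (ψ : a → ℂ) : Matrix a a ℂ := Matrix.vecMulVec ψ (star ψ)

/-- The partial trace over the second system. -/
def traceRight [Fintype b] (X : Matrix (a × b) (a × b) ℂ) : Matrix a a ℂ :=
  Matrix.of fun i j => ∑ k, X (i, k) (j, k)

/-- `ψ` is a purification of `ρ`, with second system as purifying system. -/
def IsPurification [Fintype b] (ψ : a × b → ℂ) (ρ : Matrix a a ℂ) : Prop :=
  traceRight (ketBra ψ) = ρ

/-- The partial transpose on the second system. -/
def partialTranspose : SuperOp (a × b) (a × b) where
  toFun X := Matrix.of fun i j => X (i.1, j.2) (j.1, i.2)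
  map_add' _ _ := rfl
  map_smul' _ _ := rfl

/-- The Choi matrix `(id_a ⊗ Φ)(|Ω⟩⟨Ω|)`, where `|Ω⟩ = ∑ i, |i⟩|i⟩`. -/
def choi [DecidableEq a] (Φ : SuperOp a b) : Matrix (a × b) (a × b) ℂ :=
  idTensor a Φ (ketBra fun i : a × a => if i.1 = i.2 then 1 else 0)

end Basic

section Divergence

variable {a : Type} [Fintype a] [DecidableEq a]

/-- The real power `X ^ s` of a positive semidefinite matrix, by functional calculus. As
`0 ^ s = 0` for `s ≠ 0`, negative powers are taken on the support of `X`. -/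
def mpow (X : Matrix a a ℂ) (s : ℝ) : Matrix a a ℂ := cfc (fun x : ℝ => x ^ s) X

/-- The trace norm `tr √(X† X)`. -/
def traceNorm (X : Matrix a a ℂ) : ℝ := (cfc Real.sqrt (Xᴴ * X)).trace.re

/-- Inclusion of supports of Hermitian matrices; the support of a Hermitian matrix is its range. -/
def SuppLE (X Y : Matrix a a ℂ) : Prop :=
  LinearMap.range (Matrix.mulVecLin X) ≤ LinearMap.range (Matrix.mulVecLin Y)

/-- The weighted matrix geometric mean
`G_s(X, Y) = X^(1/2) (X^(-1/2) Y X^(-1/2))^s X^(1/2)`. -/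
def geomMean (s : ℝ) (X Y : Matrix a a ℂ) : Matrix a a ℂ :=
  mpow X (1 / 2) * mpow (mpow X (-1 / 2) * Y * mpow X (-1 / 2)) s * mpow X (1 / 2)

/-- The geometric Rényi divergence (base two), equal to `+∞` unless `supp ρ ⊆ supp σ`.
For positive definite `ρ`, `σ` one has `G_{1-α}(ρ, σ) = G_α(σ, ρ)`; the right-hand side, with
inverses on the support of `σ`, is the extension of `G_{1-α}(ρ, σ)` to all `ρ ≪ σ`
(for instance `tr (ρ σ⁻¹ ρ)` at `α = 2`). -/
def geomRenyi (α : ℝ) (ρ σ : Matrix a a ℂ) : EReal :=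
  open Classical in
  if SuppLE ρ σ then ((1 / (α - 1) * Real.logb 2 (geomMean α σ ρ).trace.re : ℝ) : EReal) else ⊤

/-- The max-relative entropy (base two), equal to `+∞` when no `t` satisfies `ρ ≤ t σ`. -/
def dMax (ρ σ : Matrix a a ℂ) : EReal :=
  ⨅ (t : ℝ) (_ : 0 < t ∧ (t • σ - ρ).PosSemidef), ((Real.logb 2 t : ℝ) : EReal)

end Divergence

section Information

variable {A B : Type} [Fintype A] [DecidableEq A] [Fintype B] [DecidableEq B]

/-- The Theta set: completely positive maps `M` for which some `Y` satisfies
`Y ± J_M^{T_B} ≥ 0` and `tr_B Y ≤ 1`. -/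
def thetaSet (A B : Type) [Fintype A] [DecidableEq A] [Fintype B] : Set (SuperOp A B) :=
  {M | IsCP M ∧ ∃ Y : Matrix (A × B) (A × B) ℂ,
    (Y + partialTranspose (choi M)).PosSemidef ∧
    (Y - partialTranspose (choi M)).PosSemidef ∧
    (1 - traceRight Y).PosSemidef}

/-- The Rains set `PPT'(A:B)`. -/
def rainsSet (A B : Type) [Fintype A] [DecidableEq A] [Fintype B] [DecidableEq B] :
    Set (Matrix (A × B) (A × B) ℂ) :=
  {σ | σ.PosSemidef ∧ traceNorm (partialTranspose σ) ≤ 1}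

/-- The geometric Rényi channel divergence: the largest divergence of the outputs of the two maps
on a purification `φ` of an input state; the first factor is the reference system. -/
def geomRenyiChannel (α : ℝ) (N M : SuperOp A B) : EReal :=
  ⨆ (ρ : Matrix A A ℂ) (_ : IsState ρ) (φ : A × A → ℂ) (_ : IsPurification φ ρ),
    geomRenyi α (idTensor A N (ketBra φ)) (idTensor A M (ketBra φ))

/-- The geometric Rényi Theta-information of a channel. -/
def geomThetaInfo (α : ℝ) (N : SuperOp A B) : EReal :=
  ⨅ M ∈ thetaSet A B, geomRenyiChannel α N M

/-- The max-Rains information of a channel. -/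
def maxRains (N : SuperOp A B) : EReal :=
  ⨆ (ρ : Matrix A A ℂ) (_ : IsState ρ) (φ : A × A → ℂ) (_ : IsPurification φ ρ),
    ⨅ σ ∈ rainsSet A B, dMax (idTensor A N (ketBra φ)) σ

end Information

section Operations

/-- PPT operations from the bipartite system `a : b` to `c : d`: channels `P` such that
`T_d ∘ P ∘ T_b` is completely positive. -/
def IsPPTOp {a b c d : Type} [Fintype a] [Fintype b] [Fintype c] [Fintype d]
    (P : SuperOp (a × b) (c × d)) : Prop :=
  IsChannel P ∧ IsCP (partialTranspose ∘ₗ P ∘ₗ partialTranspose)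

/-- LOCC operations from the bipartite system `a : b` to `c : d`: finite compositions of rounds
in which one party applies an instrument and sends the outcome to the other party, who applies a
channel that depends on it. Classical memory is kept in the local systems. -/
inductive IsLOCC : ∀ {a b c d : Type} [Fintype a] [Fintype b] [Fintype c] [Fintype d],
    SuperOp (a × b) (c × d) → Prop
  | aliceToBob {a b c d : Type} [Fintype a] [Fintype b] [Fintype c] [Fintype d] {k : ℕ}
      (E : Fin k → SuperOp a c) (F : Fin k → SuperOp b d)
      (hE : ∀ x, IsCP (E x)) (hE' : IsTP (∑ x, E x)) (hF : ∀ x, IsChannel (F x)) :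
      IsLOCC (∑ x, tensorMap (E x) (F x))
  | bobToAlice {a b c d : Type} [Fintype a] [Fintype b] [Fintype c] [Fintype d] {k : ℕ}
      (E : Fin k → SuperOp a c) (F : Fin k → SuperOp b d)
      (hE : ∀ x, IsChannel (E x)) (hF : ∀ x, IsCP (F x)) (hF' : IsTP (∑ x, F x)) :
      IsLOCC (∑ x, tensorMap (E x) (F x))
  | comp {a b c d e f : Type} [Fintype a] [Fintype b] [Fintype c] [Fintype d]
      [Fintype e] [Fintype f]
      {P : SuperOp (a × b) (c × d)} {Q : SuperOp (c × d) (e × f)}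
      (hP : IsLOCC P) (hQ : IsLOCC Q) : IsLOCC (Q ∘ₗ P)

/-- A class of bipartite operations: a predicate on maps from operators on `a : b` to operators
on `c : d`. -/
abbrev OpClass : Type 1 :=
  ∀ (a b c d : Type) [Fintype a] [Fintype b] [Fintype c] [Fintype d],
    SuperOp (a × b) (c × d) → Prop

/-- The class of PPT operations. -/
def pptClass : OpClass := fun _ _ _ _ _ _ _ _ P => IsPPTOp P

/-- The class of LOCC operations. -/
def loccClass : OpClass := fun _ _ _ _ _ _ _ _ P => IsLOCC P

end Operations

section Protocol

variable {A B : Type} [Fintype A] [Fintype B]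

/-- One use of `N`: Alice holds `p` and `A`, Bob holds `q`; she sends `A` through `N` and Bob
receives `B`. -/
def useChannel {p q : Type} (N : SuperOp A B)
    (X : Matrix ((p × A) × q) ((p × A) × q) ℂ) : Matrix (p × (B × q)) (p × (B × q)) ℂ :=
  Matrix.of fun i j =>
    N (Matrix.of fun x y => X ((i.1, x), i.2.2) ((j.1, y), j.2.2)) i.2.1 j.2.1

/-- `Reach O N n p q σ`: the state `σ`, on Alice's memory of dimension `p`, Bob's channel output
`B` and Bob's memory of dimension `q`, occurs right after the `n`-th use of `N` in a protocol
that starts from trivial systems and applies an operation of the class `O` before each use. -/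
inductive Reach (O : OpClass) (N : SuperOp A B) : ℕ → (p q : ℕ) →
    Matrix (Fin p × (B × Fin q)) (Fin p × (B × Fin q)) ℂ → Prop
  | first {p q : ℕ} (P : SuperOp (Unit × Unit) ((Fin p × A) × Fin q))
      (hP : O Unit Unit (Fin p × A) (Fin q) P) :
      Reach O N 1 p q (useChannel N (P 1))
  | step {n p q p' q' : ℕ} {σ : Matrix (Fin p × (B × Fin q)) (Fin p × (B × Fin q)) ℂ}
      (hσ : Reach O N n p q σ)
      (P : SuperOp (Fin p × (B × Fin q)) ((Fin p' × A) × Fin q'))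
      (hP : O (Fin p) (B × Fin q) (Fin p' × A) (Fin q') P) :
      Reach O N (n + 1) p' q' (useChannel N (P σ))

/-- The maximally entangled state of two `k`-dimensional systems. -/
def maxEntangled (k : ℕ) : Matrix (Fin k × Fin k) (Fin k × Fin k) ℂ :=
  (k : ℂ)⁻¹ • ketBra fun i : Fin k × Fin k => if i.1 = i.2 then 1 else 0

/-- There is an `O`-assisted protocol with `n ≥ 1` uses of `N` whose final state `ω`, obtained
by a last operation of the class `O`, satisfies `tr (Φ_k ω) ≥ 1 - ε`. -/
def HasProtocol (O : OpClass) (N : SuperOp A B) (n k : ℕ) (ε : ℝ) : Prop :=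
  ∃ (p q : ℕ) (σ : Matrix (Fin p × (B × Fin q)) (Fin p × (B × Fin q)) ℂ)
    (P : SuperOp (Fin p × (B × Fin q)) (Fin k × Fin k)),
    Reach O N n p q σ ∧ O (Fin p) (B × Fin q) (Fin k) (Fin k) P ∧
    1 - ε ≤ (maxEntangled k * P σ).trace.re

/-- Achievable rates of `O`-assisted quantum communication, in qubits per channel use. -/
def IsAchievable (O : OpClass) (N : SuperOp A B) (r : ℝ) : Prop :=
  ∀ ε : ℝ, 0 < ε → ε < 1 → ∀ δ : ℝ, 0 < δ → ∀ᶠ n : ℕ in Filter.atTop,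
    ∃ k : ℕ, (2 : ℝ) ^ ((n : ℝ) * (r - δ)) ≤ (k : ℝ) ∧ HasProtocol O N n k ε

/-- Strong converse rates: above them no fixed error `ε < 1` is possible for large `n`. -/
def IsStrongConverseRate (O : OpClass) (N : SuperOp A B) (r : ℝ) : Prop :=
  ∀ ε : ℝ, 0 ≤ ε → ε < 1 → ∀ δ : ℝ, 0 < δ → ∀ᶠ n : ℕ in Filter.atTop,
    ¬ ∃ k : ℕ, (2 : ℝ) ^ ((n : ℝ) * (r + δ)) ≤ (k : ℝ) ∧ HasProtocol O N n k ε

/-- The `O`-assisted quantum capacity. -/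
def capacity (O : OpClass) (N : SuperOp A B) : EReal :=
  ⨆ (r : ℝ) (_ : IsAchievable O N r), (r : EReal)

/-- The strong converse `O`-assisted quantum capacity. -/
def strongConverseCapacity (O : OpClass) (N : SuperOp A B) : EReal :=
  ⨅ (r : ℝ) (_ : IsStrongConverseRate O N r), (r : EReal)

end Protocol

end QComm

end

open scoped Matrix ComplexOrder Kronecker MatrixOrder

noncomputable section

namespace QComm

section FunctionalCalculus

variable {m n : Type} [Fintype m] [DecidableEq m] [Fintype n] [DecidableEq n]

lemma continuousOn_spectrum (A : Matrix n n ℂ) (f : ℝ → ℝ) :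
    ContinuousOn f (spectrum ℝ A) :=
  Set.Finite.continuousOn Matrix.finite_real_spectrum f

lemma posSemidef_cfc (f : ℝ → ℝ) (A : Matrix n n ℂ) (h : ∀ x ∈ spectrum ℝ A, 0 ≤ f x) :
    (cfc f A).PosSemidef :=
  Matrix.nonneg_iff_posSemidef.1 (cfc_nonneg h)

lemma spectrum_nonneg {A : Matrix n n ℂ} (hA : A.PosSemidef) : ∀ x ∈ spectrum ℝ A, 0 ≤ x :=
  fun _ hx => spectrum_nonneg_of_nonneg (Matrix.nonneg_iff_posSemidef.2 hA) hx

lemma isHermitian_cfc (f : ℝ → ℝ) (A : Matrix n n ℂ) : (cfc f A).IsHermitian :=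
  cfc_predicate f A

lemma mul_cfc_eq_cfc_mul {A : Matrix n n ℂ} {B : Matrix m m ℂ} (hA : A.IsHermitian)
    (hB : B.IsHermitian) {V : Matrix m n ℂ} (h : V * A = B * V) (f : ℝ → ℝ) :
    V * cfc f A = cfc f B * V := by
  have fA : (spectrum ℝ A).Finite := Matrix.finite_real_spectrum
  have fB : (spectrum ℝ B).Finite := Matrix.finite_real_spectrum
  let s : Finset ℝ := fA.toFinset ∪ fB.toFinset
  let p : Polynomial ℝ := Lagrange.interpolate s id f
  have hp : ∀ x ∈ s, p.eval x = f x := fun x hx =>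
    Lagrange.eval_interpolate_at_node f (Function.injective_id.injOn) hx
  have eA : cfc f A = Polynomial.aeval A p := by
    rw [← cfc_polynomial p A hA]
    refine cfc_congr fun x hx => (hp x ?_).symm
    simp [s, hx]
  have eB : cfc f B = Polynomial.aeval B p := by
    rw [← cfc_polynomial p B hB]
    refine cfc_congr fun x hx => (hp x ?_).symm
    simp [s, hx]
  rw [eA, eB]
  have hpow : ∀ k : ℕ, V * A ^ k = B ^ k * V := by
    intro k
    induction k with
    | zero => simp
    | succ k ih => rw [pow_succ, ← Matrix.mul_assoc, ih, Matrix.mul_assoc, h, ← Matrix.mul_assoc,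
        ← pow_succ]
  rw [Polynomial.aeval_eq_sum_range, Polynomial.aeval_eq_sum_range, Matrix.mul_sum,
    Matrix.sum_mul]
  exact Finset.sum_congr rfl fun k _ => by rw [Matrix.mul_smul, Matrix.smul_mul, hpow]

omit [Fintype n] in
lemma isHermitian_diagonal_ofReal (d : n → ℝ) :
    (Matrix.diagonal fun i => (d i : ℂ)).IsHermitian :=
  Matrix.isHermitian_diagonal_of_self_adjoint _ (by ext i; simp)

lemma cfc_diagonal (d : n → ℝ) (f : ℝ → ℝ) :
    cfc f (Matrix.diagonal fun i => (d i : ℂ)) = Matrix.diagonal fun i => (f (d i) : ℂ) := by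
  have hD := isHermitian_diagonal_ofReal d
  ext i j
  let V : Matrix n Unit ℂ := Matrix.of fun x _ => if x = j then 1 else 0
  have hV : V * algebraMap ℝ (Matrix Unit Unit ℂ) (d j)
      = (Matrix.diagonal fun i => (d i : ℂ)) * V := by
    ext x y
    rw [Matrix.algebraMap_eq_diagonal, Matrix.mul_diagonal, Matrix.diagonal_mul]
    by_cases hx : x = j <;> simp [V, hx]
  have key := mul_cfc_eq_cfc_mul (cfc_predicate_algebraMap (d j) :
    IsSelfAdjoint (algebraMap ℝ (Matrix Unit Unit ℂ) (d j))) hD hV f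
  rw [cfc_algebraMap] at key
  have := congrFun (congrFun key i) ()
  rw [Matrix.algebraMap_eq_diagonal, Matrix.mul_diagonal, Matrix.mul_apply] at this
  simp only [V, Matrix.of_apply, mul_ite, mul_one, mul_zero, Finset.sum_ite_eq',
    Finset.mem_univ, if_true] at this
  rw [← this, Matrix.diagonal_apply]
  by_cases hx : i = j <;> simp [hx]

lemma cfc_kronecker {X : Matrix m m ℂ} {Z : Matrix n n ℂ} (hX : X.IsHermitian)
    (hZ : Z.IsHermitian) (f : ℝ → ℝ)
    (hf : ∀ i j, f (hX.eigenvalues i * hZ.eigenvalues j)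
      = f (hX.eigenvalues i) * f (hZ.eigenvalues j)) :
    cfc f (X ⊗ₖ Z) = cfc f X ⊗ₖ cfc f Z := by
  obtain ⟨U, hU⟩ : ∃ U : Matrix m m ℂ, U = hX.eigenvectorUnitary := ⟨_, rfl⟩
  obtain ⟨W, hW⟩ : ∃ W : Matrix n n ℂ, W = hZ.eigenvectorUnitary := ⟨_, rfl⟩
  have hUU : U * Uᴴ = 1 := by
    rw [hU]; exact Unitary.mul_star_self_of_mem hX.eigenvectorUnitary.2
  have hWW : W * Wᴴ = 1 := by
    rw [hW]; exact Unitary.mul_star_self_of_mem hZ.eigenvectorUnitary.2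
  have hUU' : Uᴴ * U = 1 := by
    rw [hU]; exact Unitary.star_mul_self_of_mem hX.eigenvectorUnitary.2
  have hWW' : Wᴴ * W = 1 := by
    rw [hW]; exact Unitary.star_mul_self_of_mem hZ.eigenvectorUnitary.2
  have sX : U * Matrix.diagonal (fun i => (hX.eigenvalues i : ℂ)) = X * U := by
    have := hX.spectral_theorem
    rw [Unitary.conjStarAlgAut_apply] at this
    conv_rhs => rw [this]
    rw [← hU, Matrix.mul_assoc, Matrix.star_eq_conjTranspose, hUU', Matrix.mul_one]
    rfl
  have sZ : W * Matrix.diagonal (fun i => (hZ.eigenvalues i : ℂ)) = Z * W := by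
    have := hZ.spectral_theorem
    rw [Unitary.conjStarAlgAut_apply] at this
    conv_rhs => rw [this]
    rw [← hW, Matrix.mul_assoc, Matrix.star_eq_conjTranspose, hWW', Matrix.mul_one]
    rfl
  have hXZ : (X ⊗ₖ Z).IsHermitian := by
    rw [Matrix.IsHermitian, Matrix.conjTranspose_kronecker, hX.eq, hZ.eq]
  have fX := mul_cfc_eq_cfc_mul (isHermitian_diagonal_ofReal _) hX sX f
  have fZ := mul_cfc_eq_cfc_mul (isHermitian_diagonal_ofReal _) hZ sZ f
  have hdiag : ∀ (d : m → ℝ) (e : n → ℝ), (Matrix.diagonal fun i => (d i : ℂ)) ⊗ₖ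
      (Matrix.diagonal fun i => (e i : ℂ)) =
      Matrix.diagonal fun i : m × n => ((d i.1 * e i.2 : ℝ) : ℂ) := by
    intro d e
    rw [Matrix.diagonal_kronecker_diagonal]
    congr 1
    ext i
    push_cast
    rfl
  have sXZ : (U ⊗ₖ W) * Matrix.diagonal
      (fun i : m × n => ((hX.eigenvalues i.1 * hZ.eigenvalues i.2 : ℝ) : ℂ))
      = (X ⊗ₖ Z) * (U ⊗ₖ W) := by
    rw [← hdiag, ← Matrix.mul_kronecker_mul, ← Matrix.mul_kronecker_mul, sX, sZ]
  have fXZ := mul_cfc_eq_cfc_mul (isHermitian_diagonal_ofReal _) hXZ sXZ f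
  rw [cfc_diagonal] at fX fZ fXZ
  simp only [hf] at fXZ
  rw [← hdiag (fun i => f (hX.eigenvalues i)) (fun i => f (hZ.eigenvalues i)),
    ← Matrix.mul_kronecker_mul, fX, fZ, Matrix.mul_kronecker_mul] at fXZ
  have hone : (U ⊗ₖ W) * (Uᴴ ⊗ₖ Wᴴ) = 1 := by
    rw [← Matrix.mul_kronecker_mul, hUU, hWW, Matrix.one_kronecker_one]
  calc cfc f (X ⊗ₖ Z) = cfc f (X ⊗ₖ Z) * (U ⊗ₖ W) * (Uᴴ ⊗ₖ Wᴴ) := by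
        rw [Matrix.mul_assoc, hone, Matrix.mul_one]
    _ = _ := by rw [← fXZ, Matrix.mul_assoc, hone, Matrix.mul_one]

end FunctionalCalculus

section Powers

variable {m n : Type} [Fintype m] [DecidableEq m] [Fintype n] [DecidableEq n]

lemma posSemidef_mpow {X : Matrix n n ℂ} (hX : X.PosSemidef) (s : ℝ) : (mpow X s).PosSemidef :=
  posSemidef_cfc _ _ fun x hx => Real.rpow_nonneg (spectrum_nonneg hX x hx) s

lemma mpow_one (s : ℝ) : mpow (1 : Matrix n n ℂ) s = 1 := by
  rw [mpow, cfc_apply_one, Real.one_rpow, map_one]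

lemma mpow_kronecker {X : Matrix m m ℂ} {Z : Matrix n n ℂ} (hX : X.PosSemidef)
    (hZ : Z.PosSemidef) (s : ℝ) : mpow (X ⊗ₖ Z) s = mpow X s ⊗ₖ mpow Z s :=
  cfc_kronecker hX.1 hZ.1 _ fun i j =>
    Real.mul_rpow (hX.eigenvalues_nonneg i) (hZ.eigenvalues_nonneg j)

lemma mpow_mul_mpow {X : Matrix n n ℂ} {s t : ℝ} (hX : X.PosSemidef)
    (hst : s + t ≠ 0) : mpow X s * mpow X t = mpow X (s + t) := by
  rw [mpow, mpow, ← cfc_mul _ _ _ (continuousOn_spectrum _ _) (continuousOn_spectrum _ _)]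
  exact cfc_congr fun x hx => (Real.rpow_add' (spectrum_nonneg hX x hx) hst).symm

lemma mpow_one_right {X : Matrix n n ℂ} (hX : X.PosSemidef) : mpow X 1 = X := by
  simp only [mpow, Real.rpow_one]
  exact cfc_id' ℝ X hX.1

/-- The projection onto the support of a positive semidefinite matrix. -/
def supportProj (X : Matrix n n ℂ) : Matrix n n ℂ := mpow X (1 / 2) * mpow X (-1 / 2)

lemma supportProj_eq_cfc (X : Matrix n n ℂ) (hX : X.PosSemidef) :
    supportProj X = cfc (fun x : ℝ => if x = 0 then 0 else 1) X := by
  rw [supportProj, mpow, mpow,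
    ← cfc_mul _ _ _ (continuousOn_spectrum _ _) (continuousOn_spectrum _ _)]
  refine cfc_congr fun x hx => ?_
  by_cases h : x = 0
  · simp [h]
  · have := lt_of_le_of_ne (spectrum_nonneg hX x hx) (Ne.symm h)
    simp only [h, if_false]
    rw [← Real.rpow_add this]
    norm_num

lemma supportProj_mul_mpow {X : Matrix n n ℂ} (hX : X.PosSemidef) {s : ℝ} (hs : s ≠ 0) :
    supportProj X * mpow X s = mpow X s := by
  rw [supportProj_eq_cfc X hX, mpow,
    ← cfc_mul _ _ _ (continuousOn_spectrum _ _) (continuousOn_spectrum _ _)]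
  refine cfc_congr fun x hx => ?_
  by_cases h : x = 0 <;> simp [h, Real.zero_rpow hs]

lemma isHermitian_mpow (X : Matrix n n ℂ) (s : ℝ) : (mpow X s).IsHermitian :=
  isHermitian_cfc _ _

lemma isHermitian_supportProj {X : Matrix n n ℂ} (hX : X.PosSemidef) :
    (supportProj X).IsHermitian := by
  rw [supportProj_eq_cfc X hX]
  exact isHermitian_cfc _ _

lemma supportProj_mul_self {X : Matrix n n ℂ} (hX : X.PosSemidef) : supportProj X * X = X := by
  have := supportProj_mul_mpow hX (one_ne_zero)
  rwa [mpow_one_right hX] at this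

lemma mpow_half_mul_self {X : Matrix n n ℂ} (hX : X.PosSemidef) :
    mpow X (1 / 2) * mpow X (1 / 2) = X := by
  rw [mpow_mul_mpow hX (by norm_num)]
  norm_num
  exact mpow_one_right hX

lemma mpow_neg_half_mul_half (X : Matrix n n ℂ) :
    mpow X (-1 / 2) * mpow X (1 / 2) = supportProj X :=
  (cfc_commute_cfc _ _ X).eq

omit [DecidableEq m] in
/-- Anything of the form `S` with `S Sᴴ = X` lies in the support of `X`. -/
lemma supportProj_mul_factor {X : Matrix n n ℂ} {S : Matrix n m ℂ} (h : X = S * Sᴴ) :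
    supportProj X * S = S := by
  have hX : X.PosSemidef := h ▸ Matrix.posSemidef_self_mul_conjTranspose S
  have h1 : (1 - supportProj X) * S = 0 := by
    apply Matrix.self_mul_conjTranspose_eq_zero.1
    rw [Matrix.conjTranspose_mul, Matrix.mul_assoc, ← Matrix.mul_assoc S, ← h,
      ← Matrix.mul_assoc, Matrix.sub_mul, supportProj_mul_self hX, Matrix.one_mul, sub_self,
      Matrix.zero_mul]
  rw [Matrix.sub_mul, Matrix.one_mul, sub_eq_zero] at h1
  exact h1.symm

/-- The tangent-line bound `x ^ α ≥ α c ^ (α - 1) x - (α - 1) c ^ α`. -/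
lemma posSemidef_mpow_sub_tangent {X : Matrix n n ℂ} (hX : X.PosSemidef) {α c : ℝ} (hα : 1 ≤ α)
    (hc : 0 < c) :
    (mpow X α - ((α * c ^ (α - 1)) • X - ((α - 1) * c ^ α) • 1)).PosSemidef := by
  have e : mpow X α - ((α * c ^ (α - 1)) • X - ((α - 1) * c ^ α) • 1)
      = cfc (fun x : ℝ => x ^ α - (α * c ^ (α - 1) * x - (α - 1) * c ^ α)) X := by
    rw [cfc_sub _ _ _ (continuousOn_spectrum _ _) (continuousOn_spectrum _ _),
      cfc_sub _ _ _ (continuousOn_spectrum _ _) (continuousOn_spectrum _ _),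
      cfc_const_mul_id _ _ hX.1.isSelfAdjoint, cfc_const _ _ hX.1.isSelfAdjoint,
        Algebra.algebraMap_eq_smul_one]
    rfl
  rw [e]
  refine posSemidef_cfc _ _ fun x hx => ?_
  have hx0 := spectrum_nonneg hX x hx
  have hb := one_add_mul_self_le_rpow_one_add (s := x / c - 1) (by
    have : 0 ≤ x / c := by positivity
    linarith) hα
  have hca : c ^ α = c ^ (α - 1) * c := by
    rw [← Real.rpow_add_one hc.ne']; ring_nf
  have h2 : 0 < c ^ α := by positivity
  rw [add_sub_cancel, Real.div_rpow hx0 hc.le, le_div_iff₀ h2] at hb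
  have h3 : (1 + α * (x / c - 1)) * c ^ α = α * c ^ (α - 1) * x - (α - 1) * c ^ α := by
    rw [hca]; field_simp; ring
  linarith

lemma posSemidef_smul_sub_mpow {X : Matrix n n ℂ} (hX : X.PosSemidef) {α t : ℝ} (hα : 1 < α)
    (ht : (t • 1 - X).PosSemidef) :
    (t ^ (α - 1) • X - mpow X α).PosSemidef := by
  have e : t ^ (α - 1) • X - mpow X α = cfc (fun x : ℝ => t ^ (α - 1) * x - x ^ α) X := by
    rw [cfc_sub _ _ _ (continuousOn_spectrum _ _) (continuousOn_spectrum _ _),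
      cfc_const_mul_id _ _ hX.1.isSelfAdjoint]
    rfl
  rw [e]
  refine posSemidef_cfc _ _ fun x hx => ?_
  have hx0 := spectrum_nonneg hX x hx
  have hxt : x ≤ t := by
    have h1 : cfc (fun y : ℝ => t - y) X = t • 1 - X := by
      rw [cfc_sub _ _ _ (continuousOn_spectrum _ _) (continuousOn_spectrum _ _),
        cfc_const _ _ hX.1.isSelfAdjoint, cfc_id' ℝ X hX.1.isSelfAdjoint,
        Algebra.algebraMap_eq_smul_one]
    have h2 := (cfc_nonneg_iff (fun y : ℝ => t - y) X (continuousOn_spectrum _ _)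
      hX.1.isSelfAdjoint).1
      (by rw [h1]; exact Matrix.nonneg_iff_posSemidef.2 ht) x hx
    linarith
  rcases hx0.eq_or_lt with h | h
  · rw [← h, Real.zero_rpow (by linarith)]; simp
  · have : x ^ α = x ^ (α - 1) * x := by rw [← Real.rpow_add_one h.ne']; ring_nf
    rw [this, ← sub_mul]
    have := Real.rpow_le_rpow hx0 hxt (by linarith : 0 ≤ α - 1)
    exact mul_nonneg (by linarith) hx0

end Powers

section Maps

variable {a b c d p q r : Type}

lemma superOp_apply_eq_sum [Fintype a] [DecidableEq a] (Φ : SuperOp a b) (X : Matrix a a ℂ)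
    (i j : b) : Φ X i j = ∑ x, ∑ y, X x y * Φ (Matrix.single x y 1) i j := by
  conv_lhs => rw [Matrix.matrix_eq_sum_single X]
  simp only [map_sum, Matrix.sum_apply]
  refine Finset.sum_congr rfl fun x _ => Finset.sum_congr rfl fun y _ => ?_
  have : Matrix.single x y (X x y) = X x y • Matrix.single x y (1 : ℂ) := by
    rw [Matrix.smul_single, smul_eq_mul, mul_one]
  rw [this, map_smul, Matrix.smul_apply, smul_eq_mul]

lemma choi_apply [DecidableEq a] (Φ : SuperOp a b) (x y : a) (i j : b) :
    choi Φ (x, i) (y, j) = Φ (Matrix.single x y 1) i j := by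
  have : (Matrix.of fun x' y' => ketBra (fun i : a × a => if i.1 = i.2 then (1 : ℂ) else 0)
      (x, x') (y, y')) = Matrix.single x y 1 := by
    ext x' y'
    by_cases hx : x = x' <;> by_cases hy : y = y' <;>
      simp [ketBra, Matrix.vecMulVec_apply, hx, hy]
  simp only [choi, idTensor, LinearMap.coe_mk, AddHom.coe_mk, Matrix.of_apply, this]

lemma superOp_apply_eq_choi [Fintype a] [DecidableEq a] (Φ : SuperOp a b) (X : Matrix a a ℂ)
    (i j : b) : Φ X i j = ∑ x, ∑ y, X x y * choi Φ (x, i) (y, j) := by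
  simp only [choi_apply]
  exact superOp_apply_eq_sum Φ X i j

/-- The linear map with a given Choi matrix. -/
def ofChoi [Fintype a] (J : Matrix (a × b) (a × b) ℂ) : SuperOp a b where
  toFun X := Matrix.of fun i j => ∑ x, ∑ y, X x y * J (x, i) (y, j)
  map_add' X Y := by
    ext i j
    simp [add_mul, Finset.sum_add_distrib]
  map_smul' t X := by
    ext i j
    simp [Finset.mul_sum, mul_assoc]

lemma choi_ofChoi [Fintype a] [DecidableEq a] (J : Matrix (a × b) (a × b) ℂ) :
    choi (ofChoi J) = J := by
  ext ⟨x, i⟩ ⟨y, j⟩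
  rw [choi_apply]
  simp [ofChoi, Matrix.single_apply, ite_and]

lemma posSemidef_idTensor [Fintype r] {Φ : SuperOp a b} (hΦ : IsCP Φ)
    {X : Matrix (r × a) (r × a) ℂ} (hX : X.PosSemidef) : (idTensor r Φ X).PosSemidef := by
  obtain ⟨e⟩ : Nonempty (r ≃ Fin (Fintype.card r)) := ⟨Fintype.equivFin r⟩
  have h := (hΦ _ _ (hX.submatrix (Prod.map e.symm id))).submatrix (Prod.map e id)
  convert h using 1
  ext i j
  simp [idTensor]

lemma posSemidef_ketBra [Finite a] (ψ : a → ℂ) : (ketBra ψ).PosSemidef :=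
  Matrix.posSemidef_vecMulVec_self_star ψ

lemma posSemidef_choi [Fintype a] [DecidableEq a] {Φ : SuperOp a b} (hΦ : IsCP Φ) :
    (choi Φ).PosSemidef :=
  posSemidef_idTensor hΦ (posSemidef_ketBra _)

/-- The Stinespring factor of a map whose Choi matrix is `Cᴴ * C`. -/
def stinespringFactor {e : Type} (C : Matrix e (a × b) ℂ) : Matrix b (a × e) ℂ :=
  Matrix.of fun i x => star (C x.2 (x.1, i))

lemma stinespring_of_choi_eq {e : Type} [Fintype a] [DecidableEq a] [Fintype e] [DecidableEq e]
    {Φ : SuperOp a b} {C : Matrix e (a × b) ℂ} (hC : choi Φ = Cᴴ * C) (X : Matrix a a ℂ) :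
    Φ X = stinespringFactor C * (X ⊗ₖ (1 : Matrix e e ℂ)) * (stinespringFactor C)ᴴ := by
  ext i j
  rw [superOp_apply_eq_choi, hC]
  simp only [stinespringFactor, Matrix.mul_apply, Matrix.conjTranspose_apply, Matrix.of_apply,
    Matrix.kroneckerMap_apply, star_star, Matrix.one_apply, mul_ite, mul_one, mul_zero,
    Fintype.sum_prod_type, Finset.sum_ite_eq', Finset.mem_univ, if_true, Finset.mul_sum,
    Finset.sum_mul]
  rw [Finset.sum_comm]
  refine Finset.sum_congr rfl fun y _ => ?_
  rw [Finset.sum_comm]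
  refine Finset.sum_congr rfl fun e _ => Finset.sum_congr rfl fun x _ => ?_
  ring

/-- The Stinespring form of a completely positive map. -/
lemma exists_stinespring [Fintype a] [DecidableEq a] [Fintype b] [DecidableEq b]
    {Φ : SuperOp a b} (hΦ : (choi Φ).PosSemidef) :
    ∃ L : Matrix b (a × (a × b)) ℂ, ∀ X,
      Φ X = L * (X ⊗ₖ (1 : Matrix (a × b) (a × b) ℂ)) * Lᴴ :=
  ⟨_, stinespring_of_choi_eq (C := mpow (choi Φ) (1 / 2)) (by
    rw [(isHermitian_mpow _ _).eq, mpow_half_mul_self hΦ])⟩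

lemma isCP_of_stinespring {e : Type} [Fintype a] [Fintype b] [Fintype e] [DecidableEq e]
    {Φ : SuperOp a b} (L : Matrix b (a × e) ℂ) (hL : ∀ X, Φ X = L * (X ⊗ₖ (1 : Matrix e e ℂ)) * Lᴴ) :
    IsCP Φ := by
  intro k X hX
  have h : idTensor (Fin k) Φ X = ((1 : Matrix (Fin k) (Fin k) ℂ) ⊗ₖ L) *
      (X ⊗ₖ (1 : Matrix e e ℂ)).submatrix (Equiv.prodAssoc _ _ _).symm
        (Equiv.prodAssoc _ _ _).symm * ((1 : Matrix (Fin k) (Fin k) ℂ) ⊗ₖ L)ᴴ := by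
    ext i j
    change Φ (Matrix.of fun x y => X (i.1, x) (j.1, y)) i.2 j.2 = _
    rw [hL]
    simp [Matrix.mul_apply, Fintype.sum_prod_type, Matrix.one_apply, ite_mul, Finset.sum_mul,
      apply_ite star]
  rw [h]
  exact ((hX.kronecker Matrix.PosSemidef.one).submatrix _).mul_mul_conjTranspose_same _

lemma isCP_of_posSemidef_choi [Fintype a] [DecidableEq a] [Fintype b] {Φ : SuperOp a b}
    (hΦ : (choi Φ).PosSemidef) : IsCP Φ := by
  classical
  obtain ⟨L, hL⟩ := exists_stinespring hΦ
  exact isCP_of_stinespring L hL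

lemma IsCP.posSemidef [Fintype a] [Fintype b] {Φ : SuperOp a b} (hΦ : IsCP Φ)
    {X : Matrix a a ℂ} (hX : X.PosSemidef) : (Φ X).PosSemidef := by
  classical
  obtain ⟨L, hL⟩ := exists_stinespring (posSemidef_choi hΦ)
  rw [hL]
  exact (hX.kronecker Matrix.PosSemidef.one).mul_mul_conjTranspose_same _

lemma idTensor_ketBra [Fintype a] [DecidableEq a] [Fintype b] [DecidableEq b]
    (Φ : SuperOp a b) (φ : a × a → ℂ) :
    idTensor a Φ (ketBra φ) = ((Matrix.of fun i j => φ (i, j)) ⊗ₖ (1 : Matrix b b ℂ)) * choi Φ *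
      ((Matrix.of fun i j => φ (i, j)) ⊗ₖ (1 : Matrix b b ℂ))ᴴ := by
  ext ⟨r, i⟩ ⟨s, j⟩
  simp only [idTensor, LinearMap.coe_mk, AddHom.coe_mk, Matrix.of_apply, Matrix.mul_apply,
    Matrix.conjTranspose_apply, Matrix.kroneckerMap_apply, Fintype.sum_prod_type,
    Matrix.one_apply]
  rw [superOp_apply_eq_choi]
  simp only [ketBra, Matrix.vecMulVec_apply, Matrix.of_apply, Pi.star_apply]
  rw [Finset.sum_comm]
  refine Finset.sum_congr rfl fun y _ => ?_
  simp only [mul_ite, mul_one, mul_zero, ite_mul, zero_mul, Finset.sum_ite_eq, Finset.mem_univ,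
    if_true, apply_ite star, star_zero, Finset.sum_mul]
  refine Finset.sum_congr rfl fun x _ => ?_
  ring

end Maps

section Link

variable {A B p q m n : Type} [Fintype A]

/-- The action on `X` of the linear map with Choi matrix `J`, as a bilinear expression. -/
def link (J : Matrix (A × B) (A × B) ℂ) (X : Matrix ((p × A) × q) ((p × A) × q) ℂ) :
    Matrix (p × (B × q)) (p × (B × q)) ℂ :=
  Matrix.of fun i j => ∑ x, ∑ y,
    X ((i.1, x), i.2.2) ((j.1, y), j.2.2) * J (x, i.2.1) (y, j.2.1)

lemma useChannel_eq_link [DecidableEq A] (N : SuperOp A B)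
    (X : Matrix ((p × A) × q) ((p × A) × q) ℂ) : useChannel N X = link (choi N) X := by
  ext i j
  simp only [useChannel, link, Matrix.of_apply]
  rw [superOp_apply_eq_choi]
  rfl

lemma link_add_left (J J' : Matrix (A × B) (A × B) ℂ) (X : Matrix ((p × A) × q) ((p × A) × q) ℂ) :
    link (J + J') X = link J X + link J' X := by
  ext i j
  simp [link, mul_add, Finset.sum_add_distrib]

lemma link_sub_left (J J' : Matrix (A × B) (A × B) ℂ) (X : Matrix ((p × A) × q) ((p × A) × q) ℂ) :
    link (J - J') X = link J X - link J' X := by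
  ext i j
  simp [link, mul_sub, Finset.sum_sub_distrib]

lemma link_add_right (J : Matrix (A × B) (A × B) ℂ) (X Y : Matrix ((p × A) × q) ((p × A) × q) ℂ) :
    link J (X + Y) = link J X + link J Y := by
  ext i j
  simp [link, add_mul, Finset.sum_add_distrib]

lemma link_sub_right (J : Matrix (A × B) (A × B) ℂ) (X Y : Matrix ((p × A) × q) ((p × A) × q) ℂ) :
    link J (X - Y) = link J X - link J Y := by
  ext i j
  simp [link, sub_mul, Finset.sum_sub_distrib]

lemma partialTranspose_link (J : Matrix (A × B) (A × B) ℂ)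
    (X : Matrix ((p × A) × q) ((p × A) × q) ℂ) :
    partialTranspose (link J X) = link (partialTranspose J) (partialTranspose X) := by
  rfl

/-- The factor through which `link` acts on factored arguments. -/
def linkFactor (S : Matrix (A × B) n ℂ) (T : Matrix ((p × A) × q) m ℂ) :
    Matrix (p × (B × q)) (m × n) ℂ :=
  Matrix.of fun i k => ∑ x, T ((i.1, x), i.2.2) k.1 * S (x, i.2.1) k.2

lemma link_factor [Fintype m] [Fintype n] (S S' : Matrix (A × B) n ℂ)
    (T T' : Matrix ((p × A) × q) m ℂ) :
    link (S * S'ᴴ) (T * T'ᴴ) = linkFactor S T * (linkFactor S' T')ᴴ := by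
  ext i j
  simp only [link, linkFactor, Matrix.of_apply, Matrix.mul_apply, Matrix.conjTranspose_apply,
    star_sum, star_mul', Finset.sum_mul_sum, ← Fintype.sum_prod_type']
  refine Fintype.sum_equiv ⟨fun x => (x.2.2, (x.1, x.2.1)), fun y => (y.2.1, y.2.2, y.1),
    fun _ => rfl, fun _ => rfl⟩ _ _ fun x => ?_
  simp only [Equiv.coe_fn_mk]
  ring

lemma linkFactor_mul [Fintype m] [Fintype n] (S : Matrix (A × B) n ℂ) (Z : Matrix n n ℂ)
    (T : Matrix ((p × A) × q) m ℂ) (X : Matrix m m ℂ) :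
    linkFactor (S * Z) (T * X) = linkFactor S T * (X ⊗ₖ Z) := by
  ext i j
  simp only [linkFactor, Matrix.of_apply, Matrix.mul_apply, Matrix.kroneckerMap_apply,
    Finset.sum_mul_sum, ← Fintype.sum_prod_type']
  simp only [Finset.sum_mul, ← Fintype.sum_prod_type']
  refine Fintype.sum_equiv ⟨fun x => ((x.2.1, x.2.2), x.1), fun y => (y.2, y.1.1, y.1.2),
    fun _ => rfl, fun _ => rfl⟩ _ _ fun x => ?_
  simp only [Equiv.coe_fn_mk]
  ring

end Link

section TraceInequalities

variable {n : Type} [Fintype n]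

lemma trace_mul_re_nonneg {A B : Matrix n n ℂ} (hA : A.PosSemidef) (hB : B.PosSemidef) :
    0 ≤ (A * B).trace.re := by
  classical
  rw [← mpow_half_mul_self hA, Matrix.mul_assoc, Matrix.trace_mul_comm]
  have := (hB.mul_mul_conjTranspose_same (mpow A (1 / 2))).trace_nonneg
  rw [(isHermitian_mpow A _).eq] at this
  exact (Complex.le_def.1 this).1

lemma PosSemidef.trace_re_nonneg {A : Matrix n n ℂ} (hA : A.PosSemidef) : 0 ≤ A.trace.re :=
  (Complex.le_def.1 hA.trace_nonneg).1

omit [Fintype n] in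
lemma posSemidef_of_half {A : Matrix n n ℂ} (hA : ((2 : ℝ) • A).PosSemidef) : A.PosSemidef := by
  have := hA.smul (show (0 : ℝ) ≤ 1 / 2 by norm_num)
  rwa [smul_smul, show (1 / 2 : ℝ) * 2 = 1 by norm_num, one_smul] at this

omit [Fintype n] in
lemma posSemidef_of_bounds {X Y : Matrix n n ℂ} (h : (Y + X).PosSemidef) (h' : (Y - X).PosSemidef) :
    Y.PosSemidef := by
  refine posSemidef_of_half ?_
  convert h.add h' using 1
  rw [two_smul]; abel

end TraceInequalities

section Certificates

variable {a b c d A B p q : Type} [Fintype a] [Fintype b] [Fintype c] [Fintype d]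
  [Fintype A] [Fintype B] [Fintype p] [Fintype q]

/-- `W` is obtained from a factorization `σ = S Sᴴ`, `ρ = S X Sᴴ` as `W = S X ^ α Sᴴ`. -/
def GeomCert (α : ℝ) (σ ρ W : Matrix a a ℂ) : Prop :=
  ∃ (n : Type) (_ : Fintype n) (_ : DecidableEq n) (S : Matrix a n ℂ) (X : Matrix n n ℂ),
    X.PosSemidef ∧ σ = S * Sᴴ ∧ ρ = S * X * Sᴴ ∧ W = S * mpow X α * Sᴴ

lemma GeomCert.posSemidef {α : ℝ} {σ ρ W : Matrix a a ℂ} (h : GeomCert α σ ρ W) :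
    W.PosSemidef := by
  obtain ⟨n, _, _, S, X, hX, rfl, rfl, rfl⟩ := h
  exact (posSemidef_mpow hX α).mul_mul_conjTranspose_same S

lemma GeomCert.map {α : ℝ} {σ ρ W : Matrix a a ℂ} (h : GeomCert α σ ρ W) {Φ : SuperOp a b}
    (hΦ : IsCP Φ) : GeomCert α (Φ σ) (Φ ρ) (Φ W) := by
  classical
  obtain ⟨n, _, _, S, X, hX, rfl, rfl, rfl⟩ := h
  obtain ⟨L, hL⟩ := exists_stinespring (posSemidef_choi hΦ)
  have key : ∀ Z : Matrix n n ℂ, Φ (S * Z * Sᴴ) =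
      (L * (S ⊗ₖ (1 : Matrix (a × b) (a × b) ℂ))) * (Z ⊗ₖ (1 : Matrix (a × b) (a × b) ℂ)) *
        (L * (S ⊗ₖ (1 : Matrix (a × b) (a × b) ℂ)))ᴴ := by
    intro Z
    have h1 : (S * Z * Sᴴ) ⊗ₖ (1 : Matrix (a × b) (a × b) ℂ) =
        (S ⊗ₖ (1 : Matrix (a × b) (a × b) ℂ)) * (Z ⊗ₖ (1 : Matrix (a × b) (a × b) ℂ)) *
          (S ⊗ₖ (1 : Matrix (a × b) (a × b) ℂ))ᴴ := by
      rw [Matrix.conjTranspose_kronecker, Matrix.conjTranspose_one, ← Matrix.mul_kronecker_mul,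
        ← Matrix.mul_kronecker_mul, Matrix.mul_one, Matrix.mul_one]
    rw [hL, h1, Matrix.conjTranspose_mul]
    simp only [Matrix.mul_assoc]
  refine ⟨_, inferInstance, inferInstance, L * (S ⊗ₖ (1 : Matrix (a × b) (a × b) ℂ)),
    X ⊗ₖ (1 : Matrix (a × b) (a × b) ℂ),
    hX.kronecker Matrix.PosSemidef.one, ?_, key X, ?_⟩
  · have := key 1
    rwa [Matrix.mul_one, Matrix.one_kronecker_one, Matrix.mul_one] at this
  · rw [key, mpow_kronecker hX Matrix.PosSemidef.one, mpow_one]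

omit [Fintype p] [Fintype q] [Fintype B] in
lemma GeomCert.link {α : ℝ} {J K V : Matrix (A × B) (A × B) ℂ} (hJ : GeomCert α J K V)
    {σ ρ W : Matrix ((p × A) × q) ((p × A) × q) ℂ} (h : GeomCert α σ ρ W) :
    GeomCert α (link J σ) (link K ρ) (link V W) := by
  obtain ⟨n, _, _, S, Z, hZ, rfl, rfl, rfl⟩ := hJ
  obtain ⟨m, _, _, T, X, hX, rfl, rfl, rfl⟩ := h
  refine ⟨m × n, inferInstance, inferInstance, linkFactor S T, X ⊗ₖ Z, hX.kronecker hZ,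
    link_factor _ _ _ _, ?_, ?_⟩
  · rw [link_factor, linkFactor_mul]
  · rw [link_factor, linkFactor_mul, mpow_kronecker hX hZ]

omit [Fintype p] [Fintype q] [Fintype B] in
lemma posSemidef_link {J : Matrix (A × B) (A × B) ℂ} (hJ : J.PosSemidef)
    {X : Matrix ((p × A) × q) ((p × A) × q) ℂ} (hX : X.PosSemidef)
    [Finite p] [Finite q] [Finite B] : (QComm.link J X).PosSemidef := by
  classical
  have := Fintype.ofFinite p
  have := Fintype.ofFinite q
  have := Fintype.ofFinite B
  have eJ : J = mpow J (1 / 2) * (mpow J (1 / 2))ᴴ := by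
    rw [(isHermitian_mpow J _).eq, mpow_half_mul_self hJ]
  have eX : X = mpow X (1 / 2) * (mpow X (1 / 2))ᴴ := by
    rw [(isHermitian_mpow X _).eq, mpow_half_mul_self hX]
  rw [eJ, eX, link_factor]
  exact Matrix.posSemidef_self_mul_conjTranspose _

lemma trace_link (J : Matrix (A × B) (A × B) ℂ) (X : Matrix ((p × A) × q) ((p × A) × q) ℂ) :
    (QComm.link J X).trace =
      (QComm.link ((traceRight J).submatrix Prod.fst Prod.fst : Matrix (A × Unit) (A × Unit) ℂ)
        X).trace := by
  simp only [Matrix.trace, Matrix.diag, QComm.link, Matrix.of_apply, Fintype.sum_prod_type,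
    Matrix.submatrix_apply, traceRight, Finset.univ_unique, Finset.sum_singleton, Finset.mul_sum]
  refine Finset.sum_congr rfl fun i _ => ?_
  rw [Finset.sum_comm]
  refine Finset.sum_congr rfl fun j _ => ?_
  rw [Finset.sum_comm]
  refine Finset.sum_congr rfl fun x _ => ?_
  rw [Finset.sum_comm]

lemma trace_link_le {J : Matrix (A × B) (A × B) ℂ} [DecidableEq A] {t : ℝ}
    (hJ : (t • 1 - traceRight J).PosSemidef)
    {X : Matrix ((p × A) × q) ((p × A) × q) ℂ} (hX : X.PosSemidef) :
    (QComm.link J X).trace.re ≤ t * X.trace.re := by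
  have h := PosSemidef.trace_re_nonneg (posSemidef_link
    (hJ.submatrix (Prod.fst : A × Unit → A)) hX)
  have e : (t • 1 - traceRight J).submatrix (Prod.fst : A × Unit → A) Prod.fst =
      (t • 1 : Matrix (A × Unit) (A × Unit) ℂ) -
        (traceRight J).submatrix (Prod.fst : A × Unit → A) Prod.fst := by
    ext i j
    simp [Matrix.one_apply, Prod.ext_iff]
  have h2 : (QComm.link (t • 1 : Matrix (A × Unit) (A × Unit) ℂ) X).trace = t * X.trace := by
    simp only [Matrix.trace, Matrix.diag, QComm.link, Matrix.of_apply, Fintype.sum_prod_type,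
      Finset.univ_unique, Finset.sum_singleton, Finset.mul_sum, Matrix.smul_apply,
      Matrix.one_apply, Prod.mk.injEq, and_true, smul_ite, smul_zero, mul_ite, mul_zero,
      Finset.sum_ite_eq, Finset.mem_univ, if_true, Complex.real_smul, mul_one]
    refine Finset.sum_congr rfl fun i _ => ?_
    rw [Finset.sum_comm]
    exact Finset.sum_congr rfl fun x _ => Finset.sum_congr rfl fun x _ => mul_comm _ _
  rw [e, link_sub_left, Matrix.trace_sub, ← trace_link, h2, Complex.sub_re,
    Complex.re_ofReal_mul] at h
  linarith

/-- `ρ` has geometric divergence certificate of value `c` relative to the Rains set. -/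
def RainsCert (α c : ℝ) (ρ : Matrix (a × b) (a × b) ℂ) : Prop :=
  ∃ σ Y W : Matrix (a × b) (a × b) ℂ, (Y + partialTranspose σ).PosSemidef ∧
    (Y - partialTranspose σ).PosSemidef ∧ Y.trace.re ≤ 1 ∧ GeomCert α σ ρ W ∧ W.trace.re ≤ c

omit [Fintype a] [Fintype b] in
lemma partialTranspose_partialTranspose (X : Matrix (a × b) (a × b) ℂ) :
    partialTranspose (partialTranspose X) = X := rfl

omit [Fintype a] [Fintype b] in
lemma partialTranspose_apply (X : Matrix (a × b) (a × b) ℂ) (i j : a × b) :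
    partialTranspose X i j = X (i.1, j.2) (j.1, i.2) := rfl

lemma trace_partialTranspose (X : Matrix (a × b) (a × b) ℂ) :
    (partialTranspose X).trace = X.trace := rfl

lemma RainsCert.map {α t : ℝ} {ρ : Matrix (a × b) (a × b) ℂ} (h : RainsCert α t ρ)
    {P : SuperOp (a × b) (c × d)} (hP : IsPPTOp P) : RainsCert α t (P ρ) := by
  obtain ⟨σ, Y, W, h1, h2, h3, h4, h5⟩ := h
  refine ⟨P σ, (partialTranspose ∘ₗ P ∘ₗ partialTranspose) Y, P W, ?_, ?_, ?_, h4.map hP.1.1, ?_⟩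
  · have := hP.2.posSemidef h1
    rwa [map_add] at this
  · have := hP.2.posSemidef h2
    rwa [map_sub] at this
  · rw [LinearMap.comp_apply, LinearMap.comp_apply, trace_partialTranspose, hP.1.2,
      trace_partialTranspose]
    exact h3
  · rw [hP.1.2]
    exact h5

lemma RainsCert.useChannel [DecidableEq A] {α t C : ℝ} {N M : SuperOp A B} (hM : M ∈ thetaSet A B)
    {V : Matrix (A × B) (A × B) ℂ} (hV : GeomCert α (choi M) (choi N) V) (hC : 0 ≤ C)
    (hCV : (C • 1 - traceRight V).PosSemidef)
    {ρ : Matrix ((p × A) × q) ((p × A) × q) ℂ} (h : RainsCert α t ρ) :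
    RainsCert α (C * t) (useChannel N ρ) := by
  obtain ⟨-, Z, hZ1, hZ2, hZ3⟩ := hM
  obtain ⟨σ, Y, W, h1, h2, h3, h4, h5⟩ := h
  have hY := posSemidef_of_bounds h1 h2
  refine ⟨QComm.link (choi M) σ, QComm.link Z Y, QComm.link V W, ?_, ?_, ?_, ?_, ?_⟩
  · have := (posSemidef_link hZ1 h1).add (posSemidef_link hZ2 h2)
    refine posSemidef_of_half ?_
    convert this using 1
    rw [partialTranspose_link]
    simp only [link_add_left, link_add_right, link_sub_left, link_sub_right, two_smul]
    abel
  · have := (posSemidef_link hZ1 h2).add (posSemidef_link hZ2 h1)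
    refine posSemidef_of_half ?_
    convert this using 1
    rw [partialTranspose_link]
    simp only [link_add_left, link_add_right, link_sub_left, link_sub_right, two_smul]
    abel
  · have := trace_link_le (t := 1) (by rwa [one_smul]) hY
    linarith
  · rw [useChannel_eq_link]
    exact hV.link h4
  · exact (trace_link_le hCV h4.posSemidef).trans (mul_le_mul_of_nonneg_left h5 hC)

lemma RainsCert.one (α : ℝ) : RainsCert α 1 (1 : Matrix (Unit × Unit) (Unit × Unit) ℂ) := by
  have e : partialTranspose (1 : Matrix (Unit × Unit) (Unit × Unit) ℂ) = 1 := by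
    ext i j
    rfl
  refine ⟨1, 1, 1, ?_, ?_, by simp, ?_, by simp⟩
  · rw [e]; exact Matrix.PosSemidef.one.add Matrix.PosSemidef.one
  · rw [e, sub_self]; exact Matrix.PosSemidef.zero
  · exact ⟨Unit × Unit, inferInstance, inferInstance, 1, 1, Matrix.PosSemidef.one, by simp, by simp,
      by simp [mpow_one]⟩

lemma Reach.rainsCert [DecidableEq A] {α C : ℝ} {N M : SuperOp A B} (hM : M ∈ thetaSet A B)
    {V : Matrix (A × B) (A × B) ℂ} (hV : GeomCert α (choi M) (choi N) V) (hC : 0 ≤ C)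
    (hCV : (C • 1 - traceRight V).PosSemidef) {n p q : ℕ}
    {σ : Matrix (Fin p × (B × Fin q)) (Fin p × (B × Fin q)) ℂ}
    (h : Reach pptClass N n p q σ) : RainsCert α (C ^ n) σ := by
  induction h with
  | first P hP =>
    have := ((RainsCert.one α).map hP).useChannel hM hV hC hCV
    rwa [mul_one, ← pow_one C] at this
  | step hσ P hP ih =>
    rw [pow_succ']
    exact (ih.map hP).useChannel hM hV hC hCV

end Certificates

section MaximallyEntangled

variable {k : ℕ}

lemma posSemidef_maxEntangled : (maxEntangled k).PosSemidef :=
  (posSemidef_ketBra _).smul (by positivity)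

lemma posSemidef_one_sub_maxEntangled (hk : 0 < k) : (1 - maxEntangled k).PosSemidef := by
  have hk' : (k : ℂ) ≠ 0 := by exact_mod_cast hk.ne'
  have h : maxEntangled k * maxEntangled k = maxEntangled k := by
    rw [maxEntangled, Matrix.smul_mul, Matrix.mul_smul, ketBra, Matrix.vecMulVec_mul_vecMulVec]
    have : (star fun i : Fin k × Fin k => if i.1 = i.2 then (1 : ℂ) else 0) ⬝ᵥ
        (fun i : Fin k × Fin k => if i.1 = i.2 then (1 : ℂ) else 0) = k := by
      simp [dotProduct, Fintype.sum_prod_type]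
    rw [this]
    ext i j
    simp [Matrix.vecMulVec_apply, hk']
  have h2 : 1 - maxEntangled k = (1 - maxEntangled k) * (1 - maxEntangled k)ᴴ := by
    rw [Matrix.conjTranspose_sub, Matrix.conjTranspose_one, posSemidef_maxEntangled.1.eq,
      Matrix.sub_mul, Matrix.mul_sub, Matrix.mul_sub, h]
    simp
  rw [h2]
  exact Matrix.posSemidef_self_mul_conjTranspose _

/-- The swap operator. -/
def swapOp (k : ℕ) : Matrix (Fin k × Fin k) (Fin k × Fin k) ℂ :=
  Matrix.of fun i j => if i.1 = j.2 ∧ i.2 = j.1 then 1 else 0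

lemma swapOp_mul_swapOp : swapOp k * swapOp k = 1 := by
  ext ⟨i, i'⟩ ⟨j, j'⟩
  simp [swapOp, Matrix.mul_apply, Fintype.sum_prod_type, Matrix.one_apply, ite_and]

lemma conjTranspose_swapOp : (swapOp k)ᴴ = swapOp k := by
  ext ⟨i, i'⟩ ⟨j, j'⟩
  simp only [swapOp, Matrix.conjTranspose_apply, Matrix.of_apply]
  by_cases h : i = j' <;> by_cases h' : i' = j <;> simp [h, h', eq_comm]

lemma posSemidef_one_add_swapOp : (1 + swapOp k).PosSemidef := by
  refine posSemidef_of_half ?_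
  have : (2 : ℝ) • (1 + swapOp k) = (1 + swapOp k) * (1 + swapOp k)ᴴ := by
    rw [Matrix.conjTranspose_add, Matrix.conjTranspose_one, conjTranspose_swapOp, Matrix.add_mul,
      Matrix.mul_add, Matrix.mul_add, swapOp_mul_swapOp, two_smul]
    simp
    abel
  rw [this]
  exact Matrix.posSemidef_self_mul_conjTranspose _

lemma posSemidef_one_sub_swapOp : (1 - swapOp k).PosSemidef := by
  refine posSemidef_of_half ?_
  have : (2 : ℝ) • (1 - swapOp k) = (1 - swapOp k) * (1 - swapOp k)ᴴ := by
    rw [Matrix.conjTranspose_sub, Matrix.conjTranspose_one, conjTranspose_swapOp, Matrix.sub_mul,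
      Matrix.mul_sub, Matrix.mul_sub, swapOp_mul_swapOp, two_smul]
    simp
    abel
  rw [this]
  exact Matrix.posSemidef_self_mul_conjTranspose _

lemma maxEntangled_trace_eq (X : Matrix (Fin k × Fin k) (Fin k × Fin k) ℂ) :
    (maxEntangled k * X).trace = (k : ℂ)⁻¹ * (swapOp k * partialTranspose X).trace := by
  simp [maxEntangled, swapOp, ketBra, Matrix.trace, Matrix.mul_apply, Matrix.vecMulVec_apply,
    Fintype.sum_prod_type, ite_and, Finset.mul_sum, partialTranspose_apply]

lemma maxEntangled_trace_le {X Y : Matrix (Fin k × Fin k) (Fin k × Fin k) ℂ}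
    (h : (Y + partialTranspose X).PosSemidef) (h' : (Y - partialTranspose X).PosSemidef)
    (hY : Y.trace.re ≤ 1) : (maxEntangled k * X).trace.re ≤ (k : ℝ)⁻¹ := by
  rw [maxEntangled_trace_eq]
  have h1 := trace_mul_re_nonneg posSemidef_one_add_swapOp h'
  have h2 := trace_mul_re_nonneg posSemidef_one_sub_swapOp h
  simp only [Matrix.add_mul, Matrix.sub_mul, Matrix.mul_add, Matrix.mul_sub, Matrix.one_mul,
    Matrix.trace_add, Matrix.trace_sub, Complex.add_re, Complex.sub_re] at h1 h2
  have h3 : (swapOp k * partialTranspose X).trace.re ≤ 1 := by linarith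
  have h4 : ((k : ℂ)⁻¹ * (swapOp k * partialTranspose X).trace).re =
      (k : ℝ)⁻¹ * (swapOp k * partialTranspose X).trace.re := by
    rw [← Complex.ofReal_natCast, ← Complex.ofReal_inv, Complex.re_ofReal_mul]
  rw [h4]
  exact mul_le_of_le_one_right (by positivity) h3

lemma RainsCert.fidelity_bound {α t ε : ℝ} (hα : 1 < α) (hk : 0 < k) (hε : ε < 1)
    {ω : Matrix (Fin k × Fin k) (Fin k × Fin k) ℂ} (h : RainsCert α t ω)
    (hω : 1 - ε ≤ (maxEntangled k * ω).trace.re) :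
    (1 - ε) ^ α * (k : ℝ) ^ (α - 1) ≤ t := by
  obtain ⟨σ, Y, W, h1, h2, h3, h4, h5⟩ := h
  have hσ := maxEntangled_trace_le h1 h2 h3
  have hW : (maxEntangled k * W).trace.re ≤ t := by
    have := trace_mul_re_nonneg (posSemidef_one_sub_maxEntangled hk) h4.posSemidef
    rw [Matrix.sub_mul, Matrix.one_mul, Matrix.trace_sub, Complex.sub_re] at this
    linarith
  obtain ⟨n, _, _, S, X, hX, rfl, rfl, rfl⟩ := h4
  have hk' : (0 : ℝ) < k := by exact_mod_cast hk
  have hε' : 0 < 1 - ε := by linarith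
  set c : ℝ := (1 - ε) * k with hc
  have hc0 : 0 < c := by positivity
  have key := trace_mul_re_nonneg (posSemidef_maxEntangled (k := k))
    ((posSemidef_mpow_sub_tangent hX hα.le hc0).mul_mul_conjTranspose_same S)
  have e : S * (mpow X α - ((α * c ^ (α - 1)) • X - ((α - 1) * c ^ α) • 1)) * Sᴴ =
      S * mpow X α * Sᴴ - ((α * c ^ (α - 1)) • (S * X * Sᴴ) - ((α - 1) * c ^ α) • (S * Sᴴ)) := by
    simp only [Matrix.mul_sub, Matrix.sub_mul, Matrix.mul_smul, Matrix.smul_mul, Matrix.mul_one]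
  rw [e] at key
  simp only [Matrix.mul_sub, Matrix.mul_smul, Matrix.trace_sub, Matrix.trace_smul, Complex.sub_re,
    Complex.smul_re, smul_eq_mul] at key
  have hca : c ^ α = c ^ (α - 1) * c := by rw [← Real.rpow_add_one hc0.ne']; ring_nf
  have b1 : α * c ^ (α - 1) * (1 - ε) ≤ α * c ^ (α - 1) *
      (maxEntangled k * (S * X * Sᴴ)).trace.re :=
    mul_le_mul_of_nonneg_left hω (by positivity)
  have b2 : (α - 1) * c ^ α * (maxEntangled k * (S * Sᴴ)).trace.re ≤
      (α - 1) * c ^ α * (k : ℝ)⁻¹ :=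
    mul_le_mul_of_nonneg_left hσ (mul_nonneg (by linarith) (by positivity))
  have b3 : (α - 1) * c ^ α * (k : ℝ)⁻¹ = (α - 1) * c ^ (α - 1) * (1 - ε) := by
    rw [hca, hc]; field_simp
  have b4 : (1 - ε) ^ α * (k : ℝ) ^ (α - 1) = c ^ (α - 1) * (1 - ε) := by
    rw [hc, Real.mul_rpow hε'.le hk'.le]
    have : (1 - ε) ^ α = (1 - ε) ^ (α - 1) * (1 - ε) := by
      rw [← Real.rpow_add_one hε'.ne']; ring_nf
    rw [this]; ring
  rw [b4]
  linarith

end MaximallyEntangled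

section GeometricMean

variable {n : Type} [Fintype n] [DecidableEq n]

lemma suppLE_iff_exists_mul {X Y : Matrix n n ℂ} : SuppLE X Y ↔ ∃ M, X = Y * M := by
  constructor
  · intro h
    have h1 : ∀ j, ∃ v, Y *ᵥ v = X.col j := fun j => by
      have : X.col j ∈ LinearMap.range X.mulVecLin := ⟨Pi.single j 1, by simp⟩
      exact h this
    choose v hv using h1
    refine ⟨Matrix.of fun i j => v j i, ?_⟩
    ext i j
    exact (congrFun (hv j) i).symm
  · rintro ⟨M, rfl⟩
    rw [SuppLE, Matrix.mulVecLin_mul]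
    exact LinearMap.range_comp_le_range _ _

lemma SuppLE.supportProj_mul {ρ σ : Matrix n n ℂ} (h : SuppLE ρ σ) (hσ : σ.PosSemidef) :
    supportProj σ * ρ = ρ := by
  obtain ⟨M, rfl⟩ := suppLE_iff_exists_mul.1 h
  rw [← Matrix.mul_assoc, supportProj_mul_self hσ]

/-- The operator `σ ^ (-1/2) ρ σ ^ (-1/2)`. -/
def relOp (σ ρ : Matrix n n ℂ) : Matrix n n ℂ := mpow σ (-1 / 2) * ρ * mpow σ (-1 / 2)

lemma geomMean_eq (α : ℝ) (σ ρ : Matrix n n ℂ) :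
    geomMean α σ ρ = mpow σ (1 / 2) * mpow (relOp σ ρ) α * mpow σ (1 / 2) := rfl

lemma posSemidef_relOp {σ ρ : Matrix n n ℂ} (hρ : ρ.PosSemidef) : (relOp σ ρ).PosSemidef := by
  have := hρ.mul_mul_conjTranspose_same (mpow σ (-1 / 2))
  rwa [(isHermitian_mpow σ _).eq] at this

lemma half_mul_relOp_mul_half {ρ σ : Matrix n n ℂ} (h : SuppLE ρ σ) (hσ : σ.PosSemidef)
    (hρ : ρ.PosSemidef) : mpow σ (1 / 2) * relOp σ ρ * mpow σ (1 / 2) = ρ := by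
  have h1 := h.supportProj_mul hσ
  have h2 : ρ * supportProj σ = ρ := by
    have := congrArg Matrix.conjTranspose h1
    rwa [Matrix.conjTranspose_mul, hρ.1.eq, (isHermitian_supportProj hσ).eq] at this
  calc mpow σ (1 / 2) * relOp σ ρ * mpow σ (1 / 2)
      = supportProj σ * ρ * (mpow σ (-1 / 2) * mpow σ (1 / 2)) := by
        simp only [relOp, supportProj, Matrix.mul_assoc]
    _ = ρ := by rw [mpow_neg_half_mul_half, h1, h2]

lemma geomCert_geomMean {ρ σ : Matrix n n ℂ} (h : SuppLE ρ σ) (hσ : σ.PosSemidef)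
    (hρ : ρ.PosSemidef) (α : ℝ) : GeomCert α σ ρ (geomMean α σ ρ) := by
  refine ⟨n, inferInstance, inferInstance, mpow σ (1 / 2), relOp σ ρ, posSemidef_relOp hρ, ?_, ?_, ?_⟩
  · rw [(isHermitian_mpow σ _).eq, mpow_half_mul_self hσ]
  · rw [(isHermitian_mpow σ _).eq, half_mul_relOp_mul_half h hσ hρ]
  · rw [(isHermitian_mpow σ _).eq, geomMean_eq]

lemma posSemidef_geomMean {ρ σ : Matrix n n ℂ} (hρ : ρ.PosSemidef) (α : ℝ) :
    (geomMean α σ ρ).PosSemidef := by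
  have := (posSemidef_mpow (posSemidef_relOp (σ := σ) hρ) α).mul_mul_conjTranspose_same
    (mpow σ (1 / 2))
  rwa [(isHermitian_mpow σ _).eq] at this

lemma mpow_neg_half_mul_self {X : Matrix n n ℂ} (hX : X.PosSemidef) :
    mpow X (-1 / 2) * X = mpow X (1 / 2) := by
  have h : mpow X (-1 / 2) * (mpow X (1 / 2) * mpow X (1 / 2)) = mpow X (1 / 2) := by
    rw [← Matrix.mul_assoc, mpow_neg_half_mul_half, supportProj_mul_mpow hX (by norm_num)]
  rwa [mpow_half_mul_self hX] at h

/-- Congruence invariance of the geometric mean. -/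
lemma geomMean_conj {ρ σ K K' : Matrix n n ℂ} (h : SuppLE ρ σ) (hσ : σ.PosSemidef)
    (hρ : ρ.PosSemidef) (hK : K' * K = 1) (α : ℝ) :
    geomMean α (K * σ * Kᴴ) (K * ρ * Kᴴ) = K * geomMean α σ ρ * Kᴴ := by
  obtain ⟨τ, hτ⟩ : ∃ τ, τ = K * σ * Kᴴ := ⟨_, rfl⟩
  obtain ⟨T, hT⟩ : ∃ T, T = mpow σ (1 / 2) := ⟨_, rfl⟩
  obtain ⟨R, hR⟩ : ∃ R, R = mpow τ (1 / 2) := ⟨_, rfl⟩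
  obtain ⟨R', hR'⟩ : ∃ R', R' = mpow τ (-1 / 2) := ⟨_, rfl⟩
  obtain ⟨Z, hZ⟩ : ∃ Z, Z = relOp σ ρ := ⟨_, rfl⟩
  have hTT : T * T = σ := hT ▸ mpow_half_mul_self hσ
  have hTh : Tᴴ = T := by rw [hT, (isHermitian_mpow σ _).eq]
  have hRh : Rᴴ = R := by rw [hR, (isHermitian_mpow τ _).eq]
  have hRh' : R'ᴴ = R' := by rw [hR', (isHermitian_mpow τ _).eq]
  have hτf : τ = (K * T) * (K * T)ᴴ := by
    rw [hτ, Matrix.conjTranspose_mul, hTh, ← hTT]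
    simp only [Matrix.mul_assoc]
  have hτp : τ.PosSemidef := hτf ▸ Matrix.posSemidef_self_mul_conjTranspose _
  have hRR' : R * R' = supportProj τ := by rw [hR, hR']; rfl
  have hPKT : R * (R' * (K * T)) = K * T := by
    rw [← Matrix.mul_assoc, hRR', supportProj_mul_factor hτf]
  have hKTP : T * Kᴴ * R' * R = T * Kᴴ := by
    have := congrArg Matrix.conjTranspose hPKT
    simpa only [Matrix.conjTranspose_mul, hRh, hRh', hTh, Matrix.mul_assoc] using this
  have hR'τ : R' * τ = R := by rw [hR, hR', mpow_neg_half_mul_self hτp]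
  obtain ⟨V, hV⟩ : ∃ V, V = R' * (K * T) := ⟨_, rfl⟩
  have hVh : Vᴴ = T * Kᴴ * R' := by
    rw [hV, Matrix.conjTranspose_mul, Matrix.conjTranspose_mul, hRh', hTh]
  have hK'' : Kᴴ * K'ᴴ = 1 := by rw [← Matrix.conjTranspose_mul, hK, Matrix.conjTranspose_one]
  have hQT : Vᴴ * V * T = T := by
    have h1 : Vᴴ * V * T * Kᴴ = T * Kᴴ := by
      calc Vᴴ * V * T * Kᴴ = T * Kᴴ * R' * (R' * τ) := by
            rw [hVh, hV, hτ, ← hTT]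
            simp only [Matrix.mul_assoc]
        _ = T * Kᴴ := by rw [hR'τ, hKTP]
    calc Vᴴ * V * T = Vᴴ * V * T * Kᴴ * K'ᴴ := by
          rw [Matrix.mul_assoc (Vᴴ * V * T), hK'', Matrix.mul_one]
      _ = T := by rw [h1, Matrix.mul_assoc, hK'', Matrix.mul_one]
  have hPZ : supportProj σ * Z = Z := by
    rw [hZ, relOp, ← Matrix.mul_assoc, ← Matrix.mul_assoc,
      supportProj_mul_mpow hσ (by norm_num)]
  have hQZ : Vᴴ * V * Z = Z := by
    rw [← hPZ, supportProj, ← hT, ← Matrix.mul_assoc, ← Matrix.mul_assoc, hQT]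
  have hZp : Z.PosSemidef := hZ ▸ posSemidef_relOp hρ
  have hZQ : Z * (Vᴴ * V) = Z := by
    have := congrArg Matrix.conjTranspose hQZ
    simpa only [Matrix.conjTranspose_mul, hZp.1.eq, Matrix.conjTranspose_conjTranspose] using this
  have hTZT : T * Z * T = ρ := by rw [hT, hZ, half_mul_relOp_mul_half h hσ hρ]
  have hZ' : relOp τ (K * ρ * Kᴴ) = V * Z * Vᴴ := by
    rw [relOp, ← hR', hVh, hV, ← hTZT]
    simp only [Matrix.mul_assoc]
  have hcomm : V * Z = (V * Z * Vᴴ) * V := by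
    rw [Matrix.mul_assoc (V * Z), Matrix.mul_assoc V Z, hZQ]
  have hpow : V * mpow Z α = mpow (V * Z * Vᴴ) α * V :=
    mul_cfc_eq_cfc_mul hZp.1 (hZp.mul_mul_conjTranspose_same V).1 hcomm _
  have hRV : R * V = K * T := by rw [hV, hPKT]
  have hVR : Vᴴ * R = T * Kᴴ := by rw [hVh, hKTP]
  have hVVR : V * (Vᴴ * R) = R := by
    rw [hVR, ← hR'τ, hV, hτ, ← hTT]
    simp only [Matrix.mul_assoc]
  calc geomMean α (K * σ * Kᴴ) (K * ρ * Kᴴ) = R * mpow (V * Z * Vᴴ) α * R := by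
        rw [← hτ, geomMean_eq, hZ', hR]
    _ = R * (mpow (V * Z * Vᴴ) α * V) * (Vᴴ * R) := by
        conv_lhs => rw [← hVVR]
        simp only [Matrix.mul_assoc, hVVR]
    _ = (R * V) * mpow Z α * (Vᴴ * R) := by rw [← hpow]; simp only [Matrix.mul_assoc]
    _ = K * geomMean α σ ρ * Kᴴ := by
        rw [hRV, hVR, geomMean_eq, ← hT, ← hZ]
        simp only [Matrix.mul_assoc]

lemma nonneg_of_forall_pos_add_mul {x y : ℝ} (h : ∀ ε > 0, 0 ≤ x + ε * y) : 0 ≤ x := by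
  by_contra! hx
  have := h (-x / (2 * (|y| + 1))) (by have := abs_nonneg y; apply div_pos <;> linarith)
  have h2 : -x / (2 * (|y| + 1)) * y ≤ -x / 2 := by
    have h0 : 0 ≤ -x / (2 * (|y| + 1)) := by
      have := abs_nonneg y; apply div_nonneg <;> linarith
    calc -x / (2 * (|y| + 1)) * y ≤ -x / (2 * (|y| + 1)) * (|y| + 1) :=
          mul_le_mul_of_nonneg_left (by linarith [le_abs_self y]) h0
      _ = -x / 2 := by have := abs_nonneg y; field_simp
  linarith

lemma posSemidef_of_forall_posDef {H : Matrix n n ℂ} (hH : H.IsHermitian)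
    (h : ∀ D : Matrix n n ℂ, D.PosDef → 0 ≤ (H * D).trace.re) : H.PosSemidef := by
  refine Matrix.PosSemidef.of_dotProduct_mulVec_nonneg hH fun v => ?_
  have h1 : 0 ≤ (H * Matrix.vecMulVec v (star v)).trace.re := by
    refine nonneg_of_forall_pos_add_mul (y := H.trace.re) fun ε hε => ?_
    have h2 := h (Matrix.vecMulVec v (star v) + ε • 1)
      ((Matrix.PosDef.one.smul hε).posSemidef_add (Matrix.posSemidef_vecMulVec_self_star v))
    simpa [Matrix.mul_add, Matrix.trace_add] using h2
  have h2 : (H * Matrix.vecMulVec v (star v)).trace = star v ⬝ᵥ (H *ᵥ v) := by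
    rw [Matrix.mul_vecMulVec, Matrix.trace_vecMulVec, dotProduct_comm]
  rw [h2] at h1
  rw [Complex.le_def]
  exact ⟨h1, (hH.im_star_dotProduct_mulVec_self v).symm⟩

end GeometricMean

section ChannelDivergence

variable {A B : Type} [Fintype A] [DecidableEq A] [Fintype B] [DecidableEq B]

omit [DecidableEq A] in
lemma traceRight_conj (Φ : Matrix A A ℂ) (W : Matrix (A × B) (A × B) ℂ) :
    traceRight ((Φ ⊗ₖ (1 : Matrix B B ℂ)) * W * (Φ ⊗ₖ (1 : Matrix B B ℂ))ᴴ) =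
      Φ * traceRight W * Φᴴ := by
  ext i j
  simp only [traceRight, Matrix.of_apply, Matrix.mul_apply, Fintype.sum_prod_type,
    Matrix.kroneckerMap_apply, Matrix.conjTranspose_apply, Matrix.one_apply, mul_ite, mul_one,
    mul_zero, ite_mul, zero_mul, Finset.sum_ite_eq, Finset.mem_univ, if_true, apply_ite star,
    star_zero, Finset.mul_sum, Finset.sum_mul]
  rw [Finset.sum_comm]
  refine Finset.sum_congr rfl fun x _ => ?_
  rw [Finset.sum_comm]

omit [DecidableEq A] [DecidableEq B] in
lemma trace_traceRight (W : Matrix (A × B) (A × B) ℂ) : (traceRight W).trace = W.trace := by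
  simp [traceRight, Matrix.trace, Fintype.sum_prod_type]

omit [Fintype A] [DecidableEq A] [DecidableEq B] in
lemma isHermitian_traceRight {W : Matrix (A × B) (A × B) ℂ} (hW : W.IsHermitian) :
    (traceRight W).IsHermitian := by
  ext i j
  simp only [traceRight, Matrix.conjTranspose_apply, Matrix.of_apply, star_sum]
  exact Finset.sum_congr rfl fun k _ => hW.apply _ _

omit [Fintype A] [DecidableEq A] [DecidableEq B] in
lemma posSemidef_traceRight {W : Matrix (A × B) (A × B) ℂ} (hW : W.PosSemidef) :
    (traceRight W).PosSemidef := by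
  have : traceRight W = ∑ k, W.submatrix (fun i => (i, k)) (fun i => (i, k)) := by
    ext i j
    simp [traceRight, Matrix.sum_apply]
  rw [this]
  exact Matrix.posSemidef_sum _ fun k _ => hW.submatrix _

/-- The operator `D ^ (1/2) ⊗ 1`. -/
def localSqrt (B : Type) [DecidableEq B] (D : Matrix A A ℂ) : Matrix (A × B) (A × B) ℂ :=
  mpow D (1 / 2) ⊗ₖ (1 : Matrix B B ℂ)

lemma trace_localSqrt_conj {D : Matrix A A ℂ} (hD : D.PosSemidef)
    (W : Matrix (A × B) (A × B) ℂ) :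
    (localSqrt B D * W * (localSqrt B D)ᴴ).trace = (traceRight W * D).trace := by
  rw [← trace_traceRight, localSqrt, traceRight_conj, (isHermitian_mpow D _).eq,
    Matrix.trace_mul_comm, ← Matrix.mul_assoc, mpow_half_mul_self hD, Matrix.trace_mul_comm]

lemma exists_inv_localSqrt (B : Type) [Fintype B] [DecidableEq B] {D : Matrix A A ℂ}
    (hD : D.PosDef) : ∃ R : Matrix A A ℂ,
      (R ⊗ₖ (1 : Matrix B B ℂ)) * localSqrt B D = 1 ∧
        localSqrt B D * (R ⊗ₖ (1 : Matrix B B ℂ)) = 1 := by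
  have h : IsUnit (mpow D (1 / 2)).det := by
    have h1 := (Matrix.isUnit_iff_isUnit_det D).1 hD.isUnit
    rw [← mpow_half_mul_self hD.posSemidef, Matrix.det_mul] at h1
    exact isUnit_of_mul_isUnit_left h1
  refine ⟨(mpow D (1 / 2))⁻¹, ?_, ?_⟩
  · rw [localSqrt, ← Matrix.mul_kronecker_mul, Matrix.nonsing_inv_mul _ h, Matrix.mul_one,
      Matrix.one_kronecker_one]
  · rw [localSqrt, ← Matrix.mul_kronecker_mul, Matrix.mul_nonsing_inv _ h, Matrix.mul_one,
      Matrix.one_kronecker_one]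

/-- The canonical purification of a state. -/
def purify (D : Matrix A A ℂ) : A × A → ℂ := fun i => mpow D (1 / 2) i.1 i.2

lemma isPurification_purify {D : Matrix A A ℂ} (hD : D.PosSemidef) :
    IsPurification (purify D) D := by
  ext i j
  conv_rhs => rw [← mpow_half_mul_self hD]
  simp only [purify, traceRight, ketBra, Matrix.of_apply, Matrix.vecMulVec_apply, Matrix.mul_apply,
    Pi.star_apply]
  exact Finset.sum_congr rfl fun k _ => by rw [(isHermitian_mpow D (1 / 2)).apply]

lemma idTensor_purify (N : SuperOp A B) (D : Matrix A A ℂ) :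
    idTensor A N (ketBra (purify D)) = localSqrt B D * choi N * (localSqrt B D)ᴴ :=
  idTensor_ketBra N (purify D)

lemma SuppLE.of_conj {n : Type} [Fintype n] [DecidableEq n] {X Y K K' : Matrix n n ℂ}
    (hK : K' * K = 1) (h : SuppLE (K * X * Kᴴ) (K * Y * Kᴴ)) : SuppLE X Y := by
  obtain ⟨M, hM⟩ := suppLE_iff_exists_mul.1 h
  refine suppLE_iff_exists_mul.2 ⟨Kᴴ * M * K'ᴴ, ?_⟩
  have hK' : Kᴴ * K'ᴴ = 1 := by rw [← Matrix.conjTranspose_mul, hK, Matrix.conjTranspose_one]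
  calc X = K' * K * X * (Kᴴ * K'ᴴ) := by rw [hK, hK', Matrix.one_mul, Matrix.mul_one]
    _ = K' * (K * X * Kᴴ) * K'ᴴ := by simp only [Matrix.mul_assoc]
    _ = K' * K * (Y * (Kᴴ * M * K'ᴴ)) := by rw [hM]; simp only [Matrix.mul_assoc]
    _ = _ := by rw [hK, Matrix.one_mul]

lemma geomRenyi_le_real_iff {n : Type} [Fintype n] [DecidableEq n] {α r : ℝ} (hα : 1 < α)
    {ρ σ : Matrix n n ℂ} (h : geomRenyi α ρ σ ≤ (r : EReal)) :
    SuppLE ρ σ ∧ (geomMean α σ ρ).trace.re ≤ (2 : ℝ) ^ ((α - 1) * r) := by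
  unfold geomRenyi at h
  split_ifs at h with hs
  · refine ⟨hs, ?_⟩
    rw [EReal.coe_le_coe_iff, one_div, inv_mul_le_iff₀ (by linarith)] at h
    rcases le_or_gt (geomMean α σ ρ).trace.re 0 with h0 | h0
    · exact h0.trans (by positivity)
    · exact (Real.logb_le_iff_le_rpow one_lt_two h0).1 h
  · simp at h

omit [DecidableEq A] in
lemma PosDef.trace_eq_ofReal [Nonempty A] {D : Matrix A A ℂ} (hD : D.PosDef) :
    0 < D.trace.re ∧ D.trace = (D.trace.re : ℂ) :=
  ⟨(Complex.lt_def.1 hD.trace_pos).1, Complex.ext (by simp)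
    (by simpa using (Complex.lt_def.1 hD.trace_pos).2.symm)⟩

/-- A finite bound on the channel divergence gives a certificate for the Choi matrices. -/
lemma exists_choi_certificate [Nonempty A] {N M : SuperOp A B} (hN : IsCP N) (hM : IsCP M)
    {α r : ℝ} (hα : 1 < α) (h : geomRenyiChannel α N M ≤ (r : EReal)) :
    ∃ V, GeomCert α (choi M) (choi N) V ∧
      (((2 : ℝ) ^ ((α - 1) * r)) • 1 - traceRight V).PosSemidef := by
  have hNp := posSemidef_choi hN
  have hMp := posSemidef_choi hM
  have key : ∀ D : Matrix A A ℂ, D.PosDef → D.trace = 1 → SuppLE (choi N) (choi M) ∧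
      (traceRight (geomMean α (choi M) (choi N)) * D).trace.re ≤ (2 : ℝ) ^ ((α - 1) * r) := by
    intro D hD hD1
    have h1 : geomRenyi α (idTensor A N (ketBra (purify D))) (idTensor A M (ketBra (purify D)))
        ≤ (r : EReal) := by
      refine le_trans ?_ h
      exact le_iSup₂_of_le D ⟨hD.posSemidef, hD1⟩
        (le_iSup₂_of_le (purify D) (isPurification_purify hD.posSemidef) le_rfl)
    rw [idTensor_purify, idTensor_purify] at h1
    obtain ⟨h2, h3⟩ := geomRenyi_le_real_iff hα h1
    obtain ⟨K', hK', -⟩ := exists_inv_localSqrt B hD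
    have h4 := SuppLE.of_conj hK' h2
    rw [geomMean_conj h4 hMp hNp hK', trace_localSqrt_conj hD.posSemidef] at h3
    exact ⟨h4, h3⟩
  have key2 : ∀ D : Matrix A A ℂ, D.PosDef → SuppLE (choi N) (choi M) ∧
      (traceRight (geomMean α (choi M) (choi N)) * D).trace.re ≤
        (2 : ℝ) ^ ((α - 1) * r) * D.trace.re := by
    intro D hD
    obtain ⟨ht1, ht2⟩ := PosDef.trace_eq_ofReal hD
    obtain ⟨h1, h2⟩ := key ((D.trace.re)⁻¹ • D) (hD.smul (inv_pos.2 ht1)) (by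
      rw [Matrix.trace_smul, ht2, Complex.ofReal_re, Complex.real_smul, ← Complex.ofReal_mul,
        inv_mul_cancel₀ ht1.ne', Complex.ofReal_one])
    refine ⟨h1, ?_⟩
    rw [Matrix.mul_smul, Matrix.trace_smul, Complex.smul_re, smul_eq_mul, inv_mul_le_iff₀ ht1] at h2
    linarith
  refine ⟨geomMean α (choi M) (choi N),
    geomCert_geomMean (key2 1 Matrix.PosDef.one).1 hMp hNp α, posSemidef_of_forall_posDef ?_ ?_⟩
  · refine Matrix.IsHermitian.sub ?_ (isHermitian_traceRight (posSemidef_geomMean hNp α).1)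
    exact (Matrix.PosSemidef.one.smul (by positivity : (0 : ℝ) ≤ 2 ^ ((α - 1) * r))).1
  · intro D hD
    have := (key2 D hD).2
    rw [Matrix.sub_mul, Matrix.smul_mul, Matrix.one_mul, Matrix.trace_sub, Matrix.trace_smul,
      Complex.sub_re, Complex.smul_re, smul_eq_mul]
    linarith

lemma isStrongConverseRate_of_geomRenyiChannel_le [Nonempty A] {N M : SuperOp A B} (hN : IsCP N)
    (hM : M ∈ thetaSet A B) {α r : ℝ} (hα : 1 < α)
    (h : geomRenyiChannel α N M ≤ (r : EReal)) : IsStrongConverseRate pptClass N r := by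
  obtain ⟨V, hV, hV'⟩ := exists_choi_certificate hN hM.1 hα h
  intro ε _ hε1 δ hδ
  have hε : 0 < 1 - ε := by linarith
  have hgt : ∀ᶠ n : ℕ in Filter.atTop, ((1 - ε) ^ α)⁻¹ < ((2 : ℝ) ^ (δ * (α - 1))) ^ n :=
    (tendsto_pow_atTop_atTop_of_one_lt (Real.one_lt_rpow one_lt_two
      (mul_pos hδ (by linarith)))).eventually_gt_atTop _
  filter_upwards [hgt] with n hn
  rintro ⟨k, hk, p, q, σ, P, hσ, hP, hfid⟩
  have hk0 : 0 < k := by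
    have : (0 : ℝ) < k := lt_of_lt_of_le (by positivity) hk
    exact_mod_cast this
  have h1 := ((Reach.rainsCert hM hV (by positivity) hV' hσ).map hP).fidelity_bound hα hk0 hε1 hfid
  have h2 : ((2 : ℝ) ^ ((n : ℝ) * (r + δ))) ^ (α - 1) ≤ (k : ℝ) ^ (α - 1) :=
    Real.rpow_le_rpow (by positivity) hk (by linarith)
  have h3 : ((2 : ℝ) ^ ((n : ℝ) * (r + δ))) ^ (α - 1) =
      ((2 : ℝ) ^ ((α - 1) * r)) ^ n * ((2 : ℝ) ^ (δ * (α - 1))) ^ n := by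
    rw [← Real.rpow_natCast, ← Real.rpow_natCast, ← Real.rpow_mul (by norm_num),
      ← Real.rpow_mul (by norm_num), ← Real.rpow_mul (by norm_num), ← Real.rpow_add (by norm_num)]
    ring_nf
  have hC : (0 : ℝ) < ((2 : ℝ) ^ ((α - 1) * r)) ^ n := by positivity
  have h4 : (1 - ε) ^ α * (((2 : ℝ) ^ ((α - 1) * r)) ^ n * ((2 : ℝ) ^ (δ * (α - 1))) ^ n) ≤
      ((2 : ℝ) ^ ((α - 1) * r)) ^ n :=
    le_trans (mul_le_mul_of_nonneg_left (h3 ▸ h2) (by positivity)) h1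
  have h5 : (1 - ε) ^ α * ((2 : ℝ) ^ (δ * (α - 1))) ^ n ≤ 1 := by
    refine le_of_mul_le_mul_left ?_ hC
    linarith
  rw [inv_lt_iff_one_lt_mul₀ (by positivity)] at hn
  linarith

lemma strongConverseCapacity_le_geomThetaInfo [Nonempty A] {N : SuperOp A B} (hN : IsCP N) {α : ℝ}
    (hα : 1 < α) : strongConverseCapacity pptClass N ≤ geomThetaInfo α N := by
  refine le_iInf₂ fun M hM => EReal.le_of_forall_lt_iff_le.1 fun r hr => ?_
  exact iInf₂_le r (isStrongConverseRate_of_geomRenyiChannel_le hN hM hα hr.le)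

omit [DecidableEq A] [DecidableEq B] in
lemma capacity_le_strongConverseCapacity (O : OpClass) (N : SuperOp A B) :
    capacity O N ≤ strongConverseCapacity O N := by
  refine iSup₂_le fun r hr => le_iInf₂ fun s hs => ?_
  rw [EReal.coe_le_coe_iff]
  by_contra! h
  have h1 := hr (1 / 2) (by norm_num) (by norm_num) ((r - s) / 2) (by linarith)
  have h2 := hs (1 / 2) (by norm_num) (by norm_num) ((r - s) / 2) (by linarith)
  obtain ⟨n, ⟨k, hk, hp⟩, hn⟩ := (h1.and h2).exists
  exact hn ⟨k, by rwa [show s + (r - s) / 2 = r - (r - s) / 2 by ring], hp⟩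

end ChannelDivergence

section LOCC

variable {a b c d r : Type}

lemma IsCP.comp {Φ : SuperOp a b} {Ψ : SuperOp b c} (hΨ : IsCP Ψ) (hΦ : IsCP Φ) :
    IsCP (Ψ ∘ₗ Φ) :=
  fun k X hX => hΨ k _ (hΦ k X hX)

lemma IsCP.sum {ι : Type} {s : Finset ι} {Φ : ι → SuperOp a b}
    (h : ∀ i, IsCP (Φ i)) : IsCP (∑ i ∈ s, Φ i) := by
  intro k X hX
  have e : idTensor (Fin k) (∑ i ∈ s, Φ i) X = ∑ i ∈ s, idTensor (Fin k) (Φ i) X := by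
    ext i j
    simp [idTensor, LinearMap.sum_apply, Matrix.sum_apply]
  rw [e]
  exact Matrix.posSemidef_sum _ fun i _ => h i k X hX

lemma IsCP.idTensor [Fintype r] {Φ : SuperOp a b} (h : IsCP Φ) : IsCP (idTensor r Φ) := by
  intro k X hX
  exact (posSemidef_idTensor (r := Fin k × r) h
    (hX.submatrix (Equiv.prodAssoc (Fin k) r a))).submatrix (Equiv.prodAssoc (Fin k) r b).symm

lemma IsCP.tensorId [Fintype r] {Φ : SuperOp a b} (h : IsCP Φ) : IsCP (tensorId r Φ) := by
  intro k X hX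
  exact (posSemidef_idTensor (r := Fin k × r) h
    (hX.submatrix fun i : (Fin k × r) × a => (i.1.1, (i.2, i.1.2)))).submatrix
      fun i : Fin k × (b × r) => ((i.1, i.2.2), i.2.1)

lemma IsCP.tensorMap [Fintype a] [Fintype d] {Φ : SuperOp a c} {Ψ : SuperOp b d} (hΦ : IsCP Φ)
    (hΨ : IsCP Ψ) : IsCP (tensorMap Φ Ψ) :=
  hΦ.tensorId.comp hΨ.idTensor

/-- The map `T ∘ Φ ∘ T`, with `T` the transpose. -/
def transposeConj (Φ : SuperOp a b) : SuperOp a b where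
  toFun X := (Φ Xᵀ)ᵀ
  map_add' X Y := by rw [Matrix.transpose_add, map_add, Matrix.transpose_add]
  map_smul' t X := by
    rw [Matrix.transpose_smul, map_smul, Matrix.transpose_smul, RingHom.id_apply]

lemma IsCP.transposeConj {Φ : SuperOp a b} (h : IsCP Φ) : IsCP (transposeConj Φ) :=
  fun k _ hX => (h k _ hX.transpose).transpose

lemma partialTranspose_tensorMap (Φ : SuperOp a c) (Ψ : SuperOp b d) :
    partialTranspose ∘ₗ tensorMap Φ Ψ ∘ₗ partialTranspose = tensorMap Φ (transposeConj Ψ) :=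
  rfl

lemma tensorMap_eq_idTensor_comp [Fintype a] [Fintype b] (Φ : SuperOp a c) (Ψ : SuperOp b d) :
    tensorMap Φ Ψ = QComm.idTensor c Ψ ∘ₗ QComm.tensorId b Φ := by
  classical
  refine LinearMap.ext fun X => ?_
  ext i j
  change Φ (Matrix.of fun x y => Ψ (Matrix.of fun u v => X (x, u) (y, v)) i.2 j.2) i.1 j.1 =
    Ψ (Matrix.of fun u v => Φ (Matrix.of fun x y => X (x, u) (y, v)) i.1 j.1) i.2 j.2
  rw [superOp_apply_eq_sum Φ, superOp_apply_eq_sum Ψ]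
  simp only [Matrix.of_apply]
  simp only [superOp_apply_eq_sum Φ (Matrix.of _), superOp_apply_eq_sum Ψ (Matrix.of _),
    Matrix.of_apply, Finset.sum_mul, ← Fintype.sum_prod_type']
  refine Fintype.sum_equiv ⟨fun x => (x.2.2.1, x.2.2.2, x.1, x.2.1),
    fun x => (x.2.2.1, x.2.2.2, x.1, x.2.1), fun _ => rfl, fun _ => rfl⟩ _ _ fun x => ?_
  simp only [Equiv.coe_fn_mk]
  ring

lemma trace_idTensor [Fintype r] [Fintype a] [Fintype b] (Φ : SuperOp a b)
    (X : Matrix (r × a) (r × a) ℂ) : (QComm.idTensor r Φ X).trace =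
      ∑ i, (Φ (Matrix.of fun x y => X (i, x) (i, y))).trace := by
  simp [QComm.idTensor, Matrix.trace, Fintype.sum_prod_type]

lemma trace_tensorId [Fintype r] [Fintype a] [Fintype b] (Φ : SuperOp a b)
    (X : Matrix (a × r) (a × r) ℂ) : (QComm.tensorId r Φ X).trace =
      ∑ i, (Φ (Matrix.of fun x y => X (x, i) (y, i))).trace := by
  simp [QComm.tensorId, Matrix.trace, Fintype.sum_prod_type_right]

lemma IsTP.trace_idTensor_sum [Fintype r] [Fintype a] [Fintype b] {k : ℕ}
    {Φ : Fin k → SuperOp a b} (h : IsTP (∑ x, Φ x)) (X : Matrix (r × a) (r × a) ℂ) :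
    ∑ x, (QComm.idTensor r (Φ x) X).trace = X.trace := by
  simp only [trace_idTensor]
  rw [Finset.sum_comm]
  refine (Finset.sum_congr rfl fun i _ => ?_).trans
    (b := ∑ i, (Matrix.of fun x y => X (i, x) (i, y)).trace) ?_
  · rw [← Matrix.trace_sum, ← LinearMap.sum_apply]
    exact h _
  · simp [Matrix.trace, Fintype.sum_prod_type]

lemma IsTP.trace_tensorId_sum [Fintype r] [Fintype a] [Fintype b] {k : ℕ}
    {Φ : Fin k → SuperOp a b} (h : IsTP (∑ x, Φ x)) (X : Matrix (a × r) (a × r) ℂ) :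
    ∑ x, (QComm.tensorId r (Φ x) X).trace = X.trace := by
  simp only [trace_tensorId]
  rw [Finset.sum_comm]
  refine (Finset.sum_congr rfl fun i _ => ?_).trans
    (b := ∑ i, (Matrix.of fun x y => X (x, i) (y, i)).trace) ?_
  · rw [← Matrix.trace_sum, ← LinearMap.sum_apply]
    exact h _
  · simp [Matrix.trace, Fintype.sum_prod_type_right]

lemma IsTP.trace_idTensor [Fintype r] [Fintype a] [Fintype b] {Φ : SuperOp a b} (h : IsTP Φ)
    (X : Matrix (r × a) (r × a) ℂ) : (QComm.idTensor r Φ X).trace = X.trace := by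
  have := IsTP.trace_idTensor_sum (k := 1) (Φ := fun _ => Φ) (by simpa using h) X
  simpa using this

lemma IsTP.trace_tensorId [Fintype r] [Fintype a] [Fintype b] {Φ : SuperOp a b} (h : IsTP Φ)
    (X : Matrix (a × r) (a × r) ℂ) : (QComm.tensorId r Φ X).trace = X.trace := by
  have := IsTP.trace_tensorId_sum (k := 1) (Φ := fun _ => Φ) (by simpa using h) X
  simpa using this

lemma isPPTOp_sum_tensorMap [Fintype a] [Fintype b] [Fintype c] [Fintype d] {k : ℕ}
    {E : Fin k → SuperOp a c} {F : Fin k → SuperOp b d} (hE : ∀ x, IsCP (E x))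
    (hF : ∀ x, IsCP (F x)) (h : IsTP (∑ x, tensorMap (E x) (F x))) :
    IsPPTOp (∑ x, tensorMap (E x) (F x)) := by
  refine ⟨⟨IsCP.sum fun x => (hE x).tensorMap (hF x), h⟩, ?_⟩
  have e : partialTranspose ∘ₗ (∑ x, tensorMap (E x) (F x)) ∘ₗ partialTranspose =
      ∑ x, tensorMap (E x) (transposeConj (F x)) := by
    refine LinearMap.ext fun X => ?_
    simp only [← partialTranspose_tensorMap, LinearMap.comp_apply, LinearMap.sum_apply, map_sum]
  rw [e]
  exact IsCP.sum fun x => (hE x).tensorMap (hF x).transposeConj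

lemma IsLOCC.isPPTOp [Fintype a] [Fintype b] [Fintype c] [Fintype d]
    {P : SuperOp (a × b) (c × d)} (h : IsLOCC P) : IsPPTOp P := by
  induction h with
  | aliceToBob E F hE hE' hF =>
    refine isPPTOp_sum_tensorMap hE (fun x => (hF x).1) fun X => ?_
    rw [LinearMap.sum_apply, Matrix.trace_sum]
    simp only [tensorMap_eq_idTensor_comp, LinearMap.comp_apply, (hF _).2.trace_idTensor]
    exact hE'.trace_tensorId_sum X
  | bobToAlice E F hE hF hF' =>
    refine isPPTOp_sum_tensorMap (fun x => (hE x).1) hF fun X => ?_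
    rw [LinearMap.sum_apply, Matrix.trace_sum]
    simp only [QComm.tensorMap, LinearMap.comp_apply, (hE _).2.trace_tensorId]
    exact hF'.trace_idTensor_sum X
  | @comp _ _ _ _ _ _ _ _ _ _ _ _ P Q hP hQ ihP ihQ =>
    refine ⟨⟨ihQ.1.1.comp ihP.1.1, fun X => ?_⟩, ?_⟩
    · rw [LinearMap.comp_apply, ihQ.1.2, ihP.1.2]
    · have e : partialTranspose ∘ₗ (Q ∘ₗ P) ∘ₗ partialTranspose =
          (partialTranspose ∘ₗ Q ∘ₗ partialTranspose) ∘ₗ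
            (partialTranspose ∘ₗ P ∘ₗ partialTranspose) := by
        refine LinearMap.ext fun X => ?_
        simp only [LinearMap.comp_apply, partialTranspose_partialTranspose]
      rw [e]
      exact ihQ.2.comp ihP.2

variable {A B : Type} [Fintype A] [Fintype B]

lemma Reach.ppt_of_locc {N : SuperOp A B} {n p q : ℕ}
    {σ : Matrix (Fin p × (B × Fin q)) (Fin p × (B × Fin q)) ℂ}
    (h : Reach loccClass N n p q σ) : Reach pptClass N n p q σ := by
  induction h with
  | first P hP => exact Reach.first P (IsLOCC.isPPTOp hP)
  | step _ P hP ih => exact Reach.step ih P (IsLOCC.isPPTOp hP)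

lemma HasProtocol.ppt_of_locc {N : SuperOp A B} {n k : ℕ} {ε : ℝ}
    (h : HasProtocol loccClass N n k ε) : HasProtocol pptClass N n k ε := by
  obtain ⟨p, q, σ, P, hσ, hP, hω⟩ := h
  exact ⟨p, q, σ, P, hσ.ppt_of_locc, IsLOCC.isPPTOp hP, hω⟩

lemma strongConverseCapacity_locc_le_ppt (N : SuperOp A B) :
    strongConverseCapacity loccClass N ≤ strongConverseCapacity pptClass N := by
  refine le_iInf₂ fun r hr => iInf₂_le r fun ε hε hε1 δ hδ => ?_
  filter_upwards [hr ε hε hε1 δ hδ] with n hn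
  rintro ⟨k, hk, h⟩
  exact hn ⟨k, hk, h.ppt_of_locc⟩

end LOCC

section Minimax

variable {n : Type} [Fintype n] [DecidableEq n]

open scoped Matrix.Norms.L2Operator in
lemma posSemidef_norm_sub {W : Matrix n n ℂ} (hW : W.IsHermitian) {η : ℝ} (h : ‖W‖ ≤ η) :
    (η • 1 - W).PosSemidef := by
  have h1 : W ≤ algebraMap ℝ (Matrix n n ℂ) ‖W‖ :=
    IsSelfAdjoint.le_algebraMap_norm_self hW.isSelfAdjoint
  rw [Matrix.le_iff, Algebra.algebraMap_eq_smul_one] at h1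
  have h2 := h1.add ((Matrix.PosSemidef.one (n := n) (R := ℂ)).smul (sub_nonneg.2 h))
  have e : η • 1 - W = ‖W‖ • 1 - W + (η - ‖W‖) • 1 := by
    rw [sub_smul]
    abel
  rw [e]
  exact h2

omit [Fintype n] [DecidableEq n] in
lemma convex_posSemidef_sub (T : Matrix n n ℂ) : Convex ℝ {Z | (T - Z).PosSemidef} := by
  intro X hX Y hY a b ha hb hab
  have := (hX.smul ha).add (hY.smul hb)
  change (T - (a • X + b • Y)).PosSemidef
  convert this using 1
  rw [smul_sub, smul_sub, ← sub_eq_zero]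
  have : T = a • T + b • T := by rw [← add_smul, hab, one_smul]
  nth_rw 1 [this]
  abel

omit [DecidableEq n] in
lemma re_trace_hermitianPart (G : Matrix n n ℂ) {Z : Matrix n n ℂ} (hZ : Z.IsHermitian) :
    (((1 / 2 : ℝ) • (G + Gᴴ)) * Z).trace.re = (G * Z).trace.re := by
  have h : (Gᴴ * Z).trace = star (G * Z).trace := by
    rw [← Matrix.trace_conjTranspose, Matrix.conjTranspose_mul, hZ.eq, Matrix.trace_mul_comm]
  rw [Matrix.smul_mul, Matrix.add_mul, Matrix.trace_smul, Matrix.trace_add, h, Complex.smul_re,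
    Complex.add_re, smul_eq_mul, Complex.star_def, Complex.conj_re]
  ring

open scoped Matrix.Norms.L2Operator Pointwise in
/-- A minimax principle for convex sets of positive semidefinite matrices. -/
lemma exists_posSemidef_sub_of_forall_posDef {C : Set (Matrix n n ℂ)} (hC : Convex ℝ C)
    (hpos : ∀ Z ∈ C, Z.PosSemidef) {t t' : ℝ} (htt : t < t')
    (h : ∀ D : Matrix n n ℂ, D.PosDef → ∃ Z ∈ C, (Z * D).trace.re ≤ t * D.trace.re) :
    ∃ Z ∈ C, (t' • 1 - Z).PosSemidef := by
  by_contra! hno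
  let S : Set (Matrix n n ℂ) := {Z | (t • 1 - Z).PosSemidef}
  have hdisj : Disjoint (S + Metric.ball 0 (t' - t)) C := by
    rw [Set.disjoint_left]
    rintro _ ⟨X, hX, W, hW, rfl⟩ hXW
    refine hno _ hXW ?_
    have hXh : X.IsHermitian := by
      have := (Matrix.PosSemidef.one (n := n) (R := ℂ)).1.smul (show IsSelfAdjoint t from
        IsSelfAdjoint.all t)
      have h2 := this.sub hX.1
      rwa [sub_sub_cancel] at h2
    have hWh : W.IsHermitian := by
      have := (hpos _ hXW).1.sub hXh
      rwa [add_sub_cancel_left] at this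
    have := hX.add (posSemidef_norm_sub hWh (mem_ball_zero_iff.1 hW).le)
    convert this using 1
    simp only [sub_smul]
    abel
  obtain ⟨f, u, hf1, hf2⟩ := RCLike.geometric_hahn_banach_open (𝕜 := ℂ)
    ((convex_posSemidef_sub (t • 1)).add (convex_ball (0 : Matrix n n ℂ) (t' - t)))
    (Metric.isOpen_ball.add_left) hC hdisj
  obtain ⟨G, hG⟩ : ∃ G : Matrix n n ℂ, ∀ Z, f Z = (G * Z).trace := by
    refine ⟨Matrix.of fun i j => f (Matrix.single j i 1), fun Z => ?_⟩
    conv_lhs => rw [Matrix.matrix_eq_sum_single Z]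
    simp only [map_sum, Matrix.trace, Matrix.diag, Matrix.mul_apply, Matrix.of_apply]
    rw [Finset.sum_comm]
    refine Finset.sum_congr rfl fun x _ => Finset.sum_congr rfl fun y _ => ?_
    have : Matrix.single y x (Z y x) = Z y x • Matrix.single y x (1 : ℂ) := by
      rw [Matrix.smul_single, smul_eq_mul, mul_one]
    rw [this, map_smul, smul_eq_mul, mul_comm]
  obtain ⟨D, hD⟩ : ∃ D, D = (1 / 2 : ℝ) • (G + Gᴴ) := ⟨_, rfl⟩
  have hfD : ∀ Z : Matrix n n ℂ, Z.IsHermitian → RCLike.re (f Z) = (D * Z).trace.re := by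
    intro Z hZ
    rw [hG, hD, re_trace_hermitianPart G hZ]
    rfl
  have hlt : ∀ P : Matrix n n ℂ, P.PosSemidef → t * D.trace.re - (D * P).trace.re < u := by
    intro P hP
    have h1 : (t • 1 - P) + 0 ∈ S + Metric.ball (0 : Matrix n n ℂ) (t' - t) :=
      Set.add_mem_add (by simpa [S] using hP) (by simpa using htt)
    have h2 := hf1 _ h1
    have h3 : (t • 1 - P : Matrix n n ℂ).IsHermitian :=
      ((Matrix.PosSemidef.one (n := n) (R := ℂ)).1.smul (IsSelfAdjoint.all t)).sub hP.1
    rw [add_zero, hfD _ h3, Matrix.mul_sub, Matrix.mul_smul, Matrix.mul_one, Matrix.trace_sub,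
      Matrix.trace_smul, Complex.sub_re, Complex.smul_re, smul_eq_mul] at h2
    exact h2
  have hDh : D.IsHermitian := by
    rw [hD, Matrix.IsHermitian, Matrix.conjTranspose_smul, Matrix.conjTranspose_add,
      Matrix.conjTranspose_conjTranspose, add_comm, star_trivial]
  have hlt0 : t * D.trace.re < u := by simpa using hlt 0 Matrix.PosSemidef.zero
  have hDp : D.PosSemidef := by
    refine posSemidef_of_forall_posDef hDh fun P hP => ?_
    by_contra! hneg
    have hs : 0 ≤ (u - t * D.trace.re) / -(D * P).trace.re :=
      div_nonneg (by linarith) (by linarith)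
    have h1 := hlt _ (hP.posSemidef.smul hs)
    rw [Matrix.mul_smul, Matrix.trace_smul, Complex.smul_re, smul_eq_mul, div_neg, neg_mul,
      div_mul_cancel₀ _ hneg.ne] at h1
    linarith
  have hfin : 0 ≤ (t * D.trace.re - u) := by
    refine nonneg_of_forall_pos_add_mul (y := t * (1 : Matrix n n ℂ).trace.re) fun ε hε => ?_
    obtain ⟨Z, hZ, hZD⟩ := h (D + ε • 1) ((Matrix.PosDef.one.smul hε).posSemidef_add hDp)
    have h1 := hf2 Z hZ
    rw [hfD Z (hpos Z hZ).1, Matrix.trace_mul_comm] at h1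
    rw [Matrix.mul_add, Matrix.mul_smul, Matrix.mul_one, Matrix.trace_add, Matrix.trace_add,
      Matrix.trace_smul, Matrix.trace_smul, Complex.add_re, Complex.add_re, Complex.smul_re,
      Complex.smul_re, smul_eq_mul, smul_eq_mul] at hZD
    have h2 := mul_nonneg hε.le (PosSemidef.trace_re_nonneg (hpos Z hZ))
    linarith
  linarith

end Minimax

section MaxDivergence

variable {n : Type} [Fintype n] [DecidableEq n]

lemma isHermitian_one_sub_supportProj {σ : Matrix n n ℂ} (hσ : σ.PosSemidef) :
    (1 - supportProj σ).IsHermitian :=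
  Matrix.isHermitian_one.sub (isHermitian_supportProj hσ)

lemma posSemidef_one_sub_supportProj {σ : Matrix n n ℂ} (hσ : σ.PosSemidef) :
    (1 - supportProj σ).PosSemidef := by
  have h : supportProj σ * supportProj σ = supportProj σ := by
    nth_rw 2 [supportProj]
    rw [← Matrix.mul_assoc, supportProj_mul_mpow hσ (by norm_num)]
    rfl
  have h2 : 1 - supportProj σ = (1 - supportProj σ) * (1 - supportProj σ)ᴴ := by
    rw [(isHermitian_one_sub_supportProj hσ).eq, Matrix.sub_mul, Matrix.mul_sub, Matrix.mul_sub, h]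
    simp
  rw [h2]
  exact Matrix.posSemidef_self_mul_conjTranspose _

lemma suppLE_of_posSemidef_smul_sub {ρ σ : Matrix n n ℂ} (hρ : ρ.PosSemidef) (hσ : σ.PosSemidef)
    {t : ℝ} (h : (t • σ - ρ).PosSemidef) : SuppLE ρ σ := by
  obtain ⟨Q, hQ⟩ : ∃ Q, Q = 1 - supportProj σ := ⟨_, rfl⟩
  have hQh : Qᴴ = Q := by rw [hQ, (isHermitian_one_sub_supportProj hσ).eq]
  have hQσ : Q * σ = 0 := by
    rw [hQ, Matrix.sub_mul, Matrix.one_mul, supportProj_mul_self hσ, sub_self]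
  have h1 := h.mul_mul_conjTranspose_same Q
  rw [Matrix.mul_sub, Matrix.mul_smul, hQσ, smul_zero, zero_sub, Matrix.neg_mul] at h1
  have h2 := hρ.mul_mul_conjTranspose_same Q
  have h3 : Q * ρ * Qᴴ = 0 :=
    le_antisymm (neg_nonneg.1 (Matrix.nonneg_iff_posSemidef.2 h1))
      (Matrix.nonneg_iff_posSemidef.2 h2)
  have h4 : Q * mpow ρ (1 / 2) = 0 := by
    apply Matrix.self_mul_conjTranspose_eq_zero.1
    rw [Matrix.conjTranspose_mul, (isHermitian_mpow ρ _).eq, Matrix.mul_assoc,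
      ← Matrix.mul_assoc (mpow ρ _), mpow_half_mul_self hρ, ← Matrix.mul_assoc, h3]
  have h5 : Q * ρ = 0 := by
    rw [← mpow_half_mul_self hρ, ← Matrix.mul_assoc, h4, Matrix.zero_mul]
  rw [hQ, Matrix.sub_mul, Matrix.one_mul, sub_eq_zero] at h5
  have h6 : mpow σ (1 / 2) = σ * mpow σ (-1 / 2) := by
    have := congrArg Matrix.conjTranspose (mpow_neg_half_mul_self hσ)
    rwa [Matrix.conjTranspose_mul, (isHermitian_mpow σ _).eq, (isHermitian_mpow σ _).eq,
      hσ.1.eq, eq_comm] at this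
  refine suppLE_iff_exists_mul.2 ⟨mpow σ (-1 / 2) * (mpow σ (-1 / 2) * ρ), ?_⟩
  conv_lhs => rw [h5, supportProj, h6]
  simp only [Matrix.mul_assoc]

/-- The geometric Rényi divergence is at most the max-relative entropy. -/
lemma geomRenyi_le_logb {ρ σ : Matrix n n ℂ} (hρ : IsState ρ) (hσ : σ.PosSemidef) {α t : ℝ}
    (hα : 1 < α) (ht : 0 < t) (h : (t • σ - ρ).PosSemidef) :
    geomRenyi α ρ σ ≤ ((Real.logb 2 t : ℝ) : EReal) := by
  have hs := suppLE_of_posSemidef_smul_sub hρ.1 hσ h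
  have hX := posSemidef_relOp (σ := σ) hρ.1
  have hR : ∀ s, (mpow σ s)ᴴ = mpow σ s := fun s => (isHermitian_mpow σ s).eq
  have hconj := half_mul_relOp_mul_half hs hσ hρ.1
  have htr : ρ.trace.re = 1 := by rw [hρ.2, Complex.one_re]
  have hXt : (t • 1 - relOp σ ρ).PosSemidef := by
    have h1 := h.mul_mul_conjTranspose_same (mpow σ (-1 / 2))
    have h2 : mpow σ (-1 / 2) * (t • σ - ρ) * (mpow σ (-1 / 2))ᴴ =
        t • supportProj σ - relOp σ ρ := by
      rw [hR, Matrix.mul_sub, Matrix.sub_mul, Matrix.mul_smul, Matrix.smul_mul,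
        mpow_neg_half_mul_self hσ]
      rfl
    rw [h2] at h1
    have h3 := ((posSemidef_one_sub_supportProj hσ).smul ht.le).add h1
    convert h3 using 1
    rw [smul_sub]
    abel
  have hup : (geomMean α σ ρ).trace.re ≤ t ^ (α - 1) := by
    have h1 := PosSemidef.trace_re_nonneg
      ((posSemidef_smul_sub_mpow hX hα hXt).mul_mul_conjTranspose_same (mpow σ (1 / 2)))
    rw [hR, Matrix.mul_sub, Matrix.sub_mul, Matrix.mul_smul, Matrix.smul_mul, hconj, ← geomMean_eq,
      Matrix.trace_sub, Matrix.trace_smul, Complex.sub_re, Complex.smul_re, htr, smul_eq_mul] at h1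
    linarith
  have hlow : 0 < (geomMean α σ ρ).trace.re := by
    have hs0 := PosSemidef.trace_re_nonneg hσ
    set s := σ.trace.re with hsdef
    have hc : 0 < 1 / (1 + s) := by positivity
    set c := 1 / (1 + s) with hcdef
    have h1 := PosSemidef.trace_re_nonneg
      ((posSemidef_mpow_sub_tangent hX hα.le hc).mul_mul_conjTranspose_same (mpow σ (1 / 2)))
    rw [hR, Matrix.mul_sub, Matrix.mul_sub, Matrix.sub_mul, Matrix.sub_mul, Matrix.mul_smul,
      Matrix.smul_mul, Matrix.mul_smul, Matrix.smul_mul, hconj, ← geomMean_eq, Matrix.mul_one,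
      mpow_half_mul_self hσ, Matrix.trace_sub, Matrix.trace_sub, Matrix.trace_smul,
      Matrix.trace_smul, Complex.sub_re, Complex.sub_re, Complex.smul_re, Complex.smul_re, htr,
      smul_eq_mul, smul_eq_mul, ← hsdef] at h1
    have hca : c ^ α = c ^ (α - 1) * c := by rw [← Real.rpow_add_one hc.ne']; ring_nf
    have hcs : c * s ≤ 1 := by
      rw [hcdef, div_mul_eq_mul_div, one_mul, div_le_one (by positivity)]
      linarith
    have hca1 : 0 < c ^ (α - 1) := by positivity
    have h2 : (α - 1) * c ^ α * s ≤ (α - 1) * c ^ (α - 1) := by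
      rw [hca, show (α - 1) * (c ^ (α - 1) * c) * s = (α - 1) * c ^ (α - 1) * (c * s) by ring]
      exact mul_le_of_le_one_right (mul_nonneg (by linarith) hca1.le) hcs
    linarith
  rw [geomRenyi, if_pos hs, EReal.coe_le_coe_iff, one_div, inv_mul_le_iff₀ (by linarith),
    Real.logb_le_iff_le_rpow one_lt_two hlow, mul_comm, Real.rpow_mul (by norm_num),
    Real.rpow_logb (by norm_num) (by norm_num) ht]
  exact hup

end MaxDivergence

section TraceNorm

variable {n : Type} [Fintype n] [DecidableEq n]

lemma exists_traceNorm_bounds {H : Matrix n n ℂ} (hH : H.IsHermitian) :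
    ∃ Y : Matrix n n ℂ, (Y + H).PosSemidef ∧ (Y - H).PosSemidef ∧ Y.trace.re = traceNorm H := by
  have e : cfc Real.sqrt (Hᴴ * H) = cfc (fun x : ℝ => |x|) H := by
    rw [hH.eq, ← pow_two, ← cfc_comp_pow Real.sqrt 2 H
      (Set.Finite.continuousOn (Matrix.finite_real_spectrum.image _) _) hH.isSelfAdjoint]
    exact cfc_congr fun x _ => Real.sqrt_sq_eq_abs x
  have hid : cfc (fun x : ℝ => x) H = H := cfc_id' ℝ H hH.isSelfAdjoint
  refine ⟨cfc (fun x : ℝ => |x|) H, ?_, ?_, by rw [traceNorm, e]⟩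
  · have h := posSemidef_cfc (fun x : ℝ => |x| + x) H fun x _ => by linarith [neg_abs_le x]
    rwa [cfc_add _ _ _ (continuousOn_spectrum _ _) (continuousOn_spectrum _ _), hid] at h
  · have h := posSemidef_cfc (fun x : ℝ => |x| - x) H fun x _ => by linarith [le_abs_self x]
    rwa [cfc_sub _ _ _ (continuousOn_spectrum _ _) (continuousOn_spectrum _ _), hid] at h

end TraceNorm

section MaxRains

variable {A B : Type} [Fintype A] [DecidableEq A] [Fintype B] [DecidableEq B]

omit [DecidableEq A] in
lemma partialTranspose_conj (R : Matrix A A ℂ) (X : Matrix (A × B) (A × B) ℂ) :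
    partialTranspose ((R ⊗ₖ (1 : Matrix B B ℂ)) * X * (R ⊗ₖ (1 : Matrix B B ℂ))ᴴ) =
      (R ⊗ₖ (1 : Matrix B B ℂ)) * partialTranspose X * (R ⊗ₖ (1 : Matrix B B ℂ))ᴴ := by
  ext i j
  simp [partialTranspose_apply, Matrix.mul_apply, Fintype.sum_prod_type, Matrix.one_apply,
    apply_ite (starRingEnd ℂ)]

omit [Fintype A] [DecidableEq A] [Fintype B] [DecidableEq B] in
lemma isHermitian_partialTranspose {X : Matrix (A × B) (A × B) ℂ} (hX : X.IsHermitian) :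
    (partialTranspose X).IsHermitian := by
  ext i j
  exact hX.apply _ _

/-- Pairs `(J, Y)` with `J ≥ K` and `Y ± J ^ {T_B} ≥ 0`. -/
def rainsFeasible (K : Matrix (A × B) (A × B) ℂ) :
    Set (Matrix (A × B) (A × B) ℂ × Matrix (A × B) (A × B) ℂ) :=
  {Z | (Z.1 - K).PosSemidef ∧ (Z.2 + partialTranspose Z.1).PosSemidef ∧
    (Z.2 - partialTranspose Z.1).PosSemidef}

omit [Fintype A] [DecidableEq A] [DecidableEq B] in
lemma convex_rainsFeasible (K : Matrix (A × B) (A × B) ℂ) :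
    Convex ℝ ((fun Z => traceRight Z.2) '' rainsFeasible K) := by
  rintro _ ⟨⟨J, Y⟩, ⟨h1, h2, h3⟩, rfl⟩ _ ⟨⟨J', Y'⟩, ⟨h1', h2', h3'⟩, rfl⟩ a b ha hb hab
  refine ⟨(a • J + b • J', a • Y + b • Y'), ⟨?_, ?_, ?_⟩, ?_⟩
  · convert (h1.smul ha).add (h1'.smul hb) using 1
    have : K = a • K + b • K := by rw [← add_smul, hab, one_smul]
    nth_rw 1 [this]
    simp only [smul_sub]
    abel
  · convert (h2.smul ha).add (h2'.smul hb) using 1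
    simp only [map_add, LinearMap.map_smul_of_tower, smul_add]
    abel
  · convert (h3.smul ha).add (h3'.smul hb) using 1
    simp only [map_add, LinearMap.map_smul_of_tower, smul_sub]
    abel
  · ext i j
    simp [traceRight, Finset.sum_add_distrib, Finset.mul_sum]

/-- A bound on the max-Rains information gives feasible pairs for every input state. -/
lemma exists_rainsFeasible_of_state {N : SuperOp A B} {r : ℝ} (h : maxRains N < (r : EReal))
    {D : Matrix A A ℂ} (hD : D.PosDef) (hD1 : D.trace = 1) :
    ∃ Z ∈ rainsFeasible (choi N), (traceRight Z.2 * D).trace.re ≤ (2 : ℝ) ^ r := by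
  have h1 : ⨅ σ ∈ rainsSet A B, dMax (idTensor A N (ketBra (purify D))) σ < (r : EReal) := by
    refine lt_of_le_of_lt ?_ h
    exact le_iSup₂_of_le D ⟨hD.posSemidef, hD1⟩
      (le_iSup₂_of_le (purify D) (isPurification_purify hD.posSemidef) le_rfl)
  simp only [iInf_lt_iff, dMax] at h1
  obtain ⟨σ, ⟨hσ, hσ1⟩, s, ⟨hs, hs1⟩, hsr⟩ := h1
  rw [EReal.coe_lt_coe_iff, Real.logb_lt_iff_lt_rpow one_lt_two hs] at hsr
  rw [idTensor_purify] at hs1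
  obtain ⟨Y, hY1, hY2, hY3⟩ := exists_traceNorm_bounds (isHermitian_partialTranspose hσ.1)
  obtain ⟨R, hR1, hR2⟩ := exists_inv_localSqrt B hD
  set L := R ⊗ₖ (1 : Matrix B B ℂ) with hL
  set K := localSqrt B D with hK
  have hcancel : ∀ X : Matrix (A × B) (A × B) ℂ, L * (K * X * Kᴴ) * Lᴴ = X := by
    intro X
    have hR1' : Kᴴ * Lᴴ = 1 := by rw [← Matrix.conjTranspose_mul, hR1, Matrix.conjTranspose_one]
    calc L * (K * X * Kᴴ) * Lᴴ = (L * K) * X * (Kᴴ * Lᴴ) := by simp only [Matrix.mul_assoc]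
      _ = X := by rw [hR1, hR1', Matrix.one_mul, Matrix.mul_one]
  have hcancel' : ∀ X : Matrix (A × B) (A × B) ℂ, K * (L * X * Lᴴ) * Kᴴ = X := by
    intro X
    have hR2' : Lᴴ * Kᴴ = 1 := by rw [← Matrix.conjTranspose_mul, hR2, Matrix.conjTranspose_one]
    calc K * (L * X * Lᴴ) * Kᴴ = (K * L) * X * (Lᴴ * Kᴴ) := by simp only [Matrix.mul_assoc]
      _ = X := by rw [hR2, hR2', Matrix.one_mul, Matrix.mul_one]
  refine ⟨(s • (L * σ * Lᴴ), s • (L * Y * Lᴴ)), ⟨?_, ?_, ?_⟩, ?_⟩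
  · have := hs1.mul_mul_conjTranspose_same L
    rw [Matrix.mul_sub, Matrix.sub_mul, hcancel, Matrix.mul_smul, Matrix.smul_mul] at this
    exact this
  · have := (hY1.mul_mul_conjTranspose_same L).smul hs.le
    rw [Matrix.mul_add, Matrix.add_mul, hL, ← partialTranspose_conj, smul_add] at this
    simpa only [LinearMap.map_smul_of_tower] using this
  · have := (hY2.mul_mul_conjTranspose_same L).smul hs.le
    rw [Matrix.mul_sub, Matrix.sub_mul, hL, ← partialTranspose_conj, smul_sub] at this
    simpa only [LinearMap.map_smul_of_tower] using this
  · rw [← trace_localSqrt_conj hD.posSemidef, ← hK, Matrix.mul_smul, Matrix.smul_mul, hcancel',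
      Matrix.trace_smul, Complex.smul_re, smul_eq_mul, hY3]
    have : s * traceNorm (partialTranspose σ) ≤ s * 1 := mul_le_mul_of_nonneg_left hσ1 hs.le
    linarith

lemma exists_rainsFeasible_le [Nonempty A] {N : SuperOp A B} {r r' : ℝ}
    (h : maxRains N < (r : EReal)) (hr : r < r') :
    ∃ Z ∈ rainsFeasible (choi N), ((2 : ℝ) ^ r' • 1 - traceRight Z.2).PosSemidef := by
  have key : ∃ Z ∈ (fun Z => traceRight Z.2) '' rainsFeasible (choi N),
      ((2 : ℝ) ^ r' • 1 - Z).PosSemidef := by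
    refine exists_posSemidef_sub_of_forall_posDef (convex_rainsFeasible (choi N)) ?_
      (Real.rpow_lt_rpow_of_exponent_lt one_lt_two hr) fun D hD => ?_
    · rintro _ ⟨Z, ⟨-, h2, h3⟩, rfl⟩
      exact posSemidef_traceRight (posSemidef_of_bounds h2 h3)
    · obtain ⟨ht1, ht2⟩ := PosDef.trace_eq_ofReal hD
      obtain ⟨Z, hZ, hZD⟩ := exists_rainsFeasible_of_state h (hD.smul (inv_pos.2 ht1)) (by
        rw [Matrix.trace_smul, ht2, Complex.ofReal_re, Complex.real_smul, ← Complex.ofReal_mul,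
          inv_mul_cancel₀ ht1.ne', Complex.ofReal_one])
      refine ⟨_, ⟨Z, hZ, rfl⟩, ?_⟩
      rw [Matrix.mul_smul, Matrix.trace_smul, Complex.smul_re, smul_eq_mul,
        inv_mul_le_iff₀ ht1] at hZD
      linarith
  obtain ⟨_, ⟨Z, hZ, rfl⟩, hZ'⟩ := key
  exact ⟨Z, hZ, hZ'⟩

omit [DecidableEq A] [DecidableEq B] in
lemma isState_idTensor_ketBra {N : SuperOp A B} (hN : IsChannel N) {ρ : Matrix A A ℂ}
    (hρ : IsState ρ) {φ : A × A → ℂ} (hφ : IsPurification φ ρ) :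
    IsState (idTensor A N (ketBra φ)) := by
  refine ⟨posSemidef_idTensor hN.1 (posSemidef_ketBra φ), ?_⟩
  rw [hN.2.trace_idTensor, ← trace_traceRight, hφ, hρ.2]

lemma geomThetaInfo_le_maxRains [Nonempty A] {N : SuperOp A B} (hN : IsChannel N) {α : ℝ}
    (hα : 1 < α) : geomThetaInfo α N ≤ maxRains N := by
  refine EReal.le_of_forall_lt_iff_le.1 fun r' hr' => ?_
  obtain ⟨r, hr, hrr⟩ := EReal.lt_iff_exists_real_btwn.1 hr'
  obtain ⟨⟨J, Y⟩, ⟨h1, h2, h3⟩, h4⟩ := exists_rainsFeasible_le hr (EReal.coe_lt_coe_iff.1 hrr)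
  simp only at h1 h2 h3 h4
  have ht : (0 : ℝ) < 2 ^ r' := by positivity
  set t : ℝ := 2 ^ r' with htdef
  have hti : 0 ≤ t⁻¹ := (inv_pos.2 ht).le
  have hJ : J.PosSemidef := by simpa using h1.add (posSemidef_choi hN.1)
  have hMp : (choi (ofChoi (t⁻¹ • J))).PosSemidef := by
    rw [choi_ofChoi]
    exact hJ.smul hti
  have hM : ofChoi (t⁻¹ • J) ∈ thetaSet A B := by
    refine ⟨isCP_of_posSemidef_choi hMp, t⁻¹ • Y, ?_, ?_, ?_⟩
    · rw [choi_ofChoi, LinearMap.map_smul_of_tower, ← smul_add]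
      exact h2.smul hti
    · rw [choi_ofChoi, LinearMap.map_smul_of_tower, ← smul_sub]
      exact h3.smul hti
    · convert h4.smul hti using 1
      rw [smul_sub, smul_smul, inv_mul_cancel₀ ht.ne', one_smul]
      congr 1
      ext i j
      simp [traceRight, Finset.mul_sum]
  refine (iInf₂_le _ hM).trans (iSup₂_le fun ρ hρ => iSup₂_le fun φ hφ => ?_)
  have hlog : r' = Real.logb 2 t := by rw [htdef, Real.logb_rpow (by norm_num) (by norm_num)]
  rw [hlog]
  refine geomRenyi_le_logb (isState_idTensor_ketBra hN hρ hφ)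
    (posSemidef_idTensor hM.1 (posSemidef_ketBra φ)) hα ht ?_
  rw [idTensor_ketBra, idTensor_ketBra, choi_ofChoi, Matrix.mul_smul, Matrix.smul_mul, smul_smul,
    mul_inv_cancel₀ ht.ne', one_smul, ← Matrix.sub_mul, ← Matrix.mul_sub]
  exact h1.mul_mul_conjTranspose_same _

end MaxRains

end QComm

end

theorem mainTheorem3 {A B : Type} [Fintype A] [DecidableEq A] [Nonempty A]
    [Fintype B] [DecidableEq B] [Nonempty B]
    (N : QComm.SuperOp A B) (hN : QComm.IsChannel N)
    (α : ℝ) (hα : 1 < α) (hα' : α ≤ 2) :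
    (QComm.capacity QComm.pptClass N ≤ QComm.strongConverseCapacity QComm.pptClass N ∧
      QComm.strongConverseCapacity QComm.pptClass N ≤ QComm.geomThetaInfo α N ∧
      QComm.geomThetaInfo α N ≤ QComm.maxRains N) ∧
    (QComm.capacity QComm.loccClass N ≤ QComm.strongConverseCapacity QComm.loccClass N ∧
      QComm.strongConverseCapacity QComm.loccClass N ≤ QComm.geomThetaInfo α N) := by
  have h := QComm.strongConverseCapacity_le_geomThetaInfo hN.1 hα
  exact ⟨⟨QComm.capacity_le_strongConverseCapacity _ _, h, QComm.geomThetaInfo_le_maxRains hN hα⟩,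
    QComm.capacity_le_strongConverseCapacity _ _,
    (QComm.strongConverseCapacity_locc_le_ppt N).trans h⟩
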